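/- **Setting.** Let $M$ be a (finite-dimensional, Hausdorff, smooth) manifold. For an anchored vector bundle $(A,\rho)$ over $M$ (with $\rho:A\to TM$ a smooth bundle homomorphism), a *right-anchored product* on $A$ is an $\mathbb R$-bilinear map $T:\Gamma(A)\times\Gamma(A)\to\Gamma(A)$ with $T_{fa}b=fT_ab$ and $T_a(fb)=fT_ab+\rho(a)(f)\,b$ for $f\in C^\infty(M)$. Its bracket is $[a,b]_T=T_ab-T_ba$, and its curvature is $R^T(a,b)c=T_aT_bc-T_bT_ac-T_{[a,b]_T}c$. $(A,M,\rho,T)$ is a *left symmetric algebroid* if $R^T=0$. The dual $T^*$ is given by $\prec T^*_a\alpha,s\succ=\rho(a).\prec\alpha,s\succ-\prec\alpha,T_as\succ$ (with $A^{**}=A$). Two left symmetric algebroids $(B,M,\rho_0,S)$ and $(B^*,M,\rho_1,T)$ on dual bundles are *compatible* if the right-anchored product $$\nabla_{X+\alpha}(Y+\beta)=S_XY+T^*_\alpha Y+S^*_X\beta+T_\alpha\beta$$ on $(B\oplus B^*,\rho_0\oplus\rho_1)$ satisfies $R^\nabla(X,\alpha)Y=R^\nabla(Y,\alpha)X$ and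 $R^\nabla(\alpha,X)\beta=R^\nabla(\beta,X)\alpha$ for all $X,Y\in\Gamma(B)$, $\alpha,\beta\in\Gamma(B^*)$. A *Lie algebroid* is an anchored bundle $(A,M,\rho)$ with a Lie bracket $[\;,\;]_A$ on $\Gamma(A)$ such that $[a,fb]_A=f[a,b]_A+\rho(a)(f)\,b$. A *para-Kähler Lie algebroid* is a Lie algebroid with a pseudo-Riemannian metric $\langle\;,\;\rangle$ on $A$ (smooth, symmetric, nondegenerate, of some signature $(p,q)$) and a bundle endomorphism $K$ of $A$ such that $K^2=\mathrm{Id}_A$, $K$ is skew-symmetric for $\langle\;,\;\rangle$, and $\nabla K=0$, where $\nabla$ is the Levi-Civita connection, i.e. the linear $A$-connection with $\rho(a).\langle b,c\rangle=\langle\nabla_ab,c\rangle+\langle b,\nabla_ac\rangle$ and $\nabla_ab-\nabla_ba=[a,b]_A$. Its associated symplectic form is $\Omega_K(a,b)=\langle Ka,b\rangle$; *symplectic form* means a skew-symmetric nondegenerate form with $d_A\Omega=0$. **Theorem.** Let $(M,\nabla)$ be an affine manifold, i.e. $\nabla$ is a torsion-free flat linear connection on $TM$, and let $h$ be a symmetric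 bivector field on $M$, i.e. a smooth field of symmetric bilinear forms on $T^*M$. Let $h_\#:T^*M\to TM$ be given by $\prec\beta,h_\#(\alpha)\succ=h(\alpha,\beta)$, put $$\nabla_Xh(\alpha,\beta)=X.h(\alpha,\beta)-h(\nabla^*_X\alpha,\beta)-h(\alpha,\nabla^*_X\beta),$$ and let $\mathcal D$ be the right-anchored product on $(T^*M,h_\#)$ given by $$\prec\mathcal D_\alpha\beta,X\succ=\nabla_Xh(\alpha,\beta)+\prec\nabla^*_{h_\#(\alpha)}\beta,X\succ .$$ Then $(T^*M,M,h_\#,\mathcal D)$ is a left symmetric algebroid compatible with $(TM,M,\mathrm{Id}_{TM},\nabla)$ if and only if, for all $\alpha,\beta,\gamma\in\Omega^1(M)$, $$\nabla_{h_\#(\alpha)}h(\beta,\gamma)-\nabla_{h_\#(\beta)}h(\alpha,\gamma)=0.$$ In this case $(TM\oplus T^*M,M,[\;,\;]^{\triangleright},\mathrm{Id}_{TM}+0,\langle\;,\;\rangle_h,K_h)$ is a para-Kähler Lie algebroid, where $$[X+\alpha,Y+\beta]^{\triangleright}=[X,Y]+\nabla^*_X\beta-\nabla^*_Y\alpha,\qquad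 \langle X+\alpha,Y+\beta\rangle_h=\prec\alpha,Y\succ+\prec\beta,X\succ-2h(\alpha,\beta),$$ $$K_h(X+\alpha)=X-2h_\#(\alpha)-\alpha,$$ and its associated symplectic form is $$\Omega_0(X+\alpha,Y+\beta)=\prec\beta,X\succ-\prec\alpha,Y\succ .$$ -/

import Mathlib

open Bundle
open scoped Manifold ContDiff

set_option linter.unusedSectionVars false
set_option maxSynthPendingDepth 3

noncomputable section

namespace Algebroid

section Basic

variable {E : Type*} [NormedAddCommGroup E] [NormedSpace ℝ E]
  {M : Type*} [TopologicalSpace M] [ChartedSpace E M]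
  {F : Type*} [NormedAddCommGroup F] [NormedSpace ℝ F]
  {V : M → Type*} [TopologicalSpace (TotalSpace F V)]
  [∀ x, AddCommGroup (V x)] [∀ x, Module ℝ (V x)] [∀ x, TopologicalSpace (V x)]
  [FiberBundle F V] [VectorBundle ℝ F V]
  {F' : Type*} [NormedAddCommGroup F'] [NormedSpace ℝ F']
  {W : M → Type*} [TopologicalSpace (TotalSpace F' W)]
  [∀ x, AddCommGroup (W x)] [∀ x, Module ℝ (W x)] [∀ x, TopologicalSpace (W x)]
  [∀ x, IsTopologicalAddGroup (W x)] [∀ x, ContinuousSMul ℝ (W x)]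
  [FiberBundle F' W] [VectorBundle ℝ F' W]

/-- Smooth real functions on `M`. -/
abbrev Fn (E M : Type*) [NormedAddCommGroup E] [NormedSpace ℝ E] [TopologicalSpace M]
    [ChartedSpace E M] := C^∞⟮𝓘(ℝ, E), M; ℝ⟯

/-- Smooth global sections of the vector bundle `V`. -/
abbrev Sec (E F : Type*) [NormedAddCommGroup E] [NormedSpace ℝ E]
    [NormedAddCommGroup F] [NormedSpace ℝ F]
    {M : Type*} [TopologicalSpace M] [ChartedSpace E M]
    (V : M → Type*) [TopologicalSpace (TotalSpace F V)]
    [∀ x, TopologicalSpace (V x)] [FiberBundle F V] :=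
  Cₛ^∞⟮𝓘(ℝ, E); F, V⟯

/-- The dual bundle. -/
abbrev DualB (V : M → Type*) [∀ x, AddCommGroup (V x)] [∀ x, Module ℝ (V x)]
    [∀ x, TopologicalSpace (V x)] : M → Type _ := fun x => V x →L[ℝ] Bundle.Trivial M ℝ x

/-- The bundle of fibrewise linear maps. -/
abbrev HomB (V W : M → Type*) [∀ x, AddCommGroup (V x)] [∀ x, Module ℝ (V x)]
    [∀ x, TopologicalSpace (V x)] [∀ x, AddCommGroup (W x)] [∀ x, Module ℝ (W x)]
    [∀ x, TopologicalSpace (W x)] : M → Type _ := fun x => V x →L[ℝ] W x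

/-- The tangent bundle. -/
abbrev TB (E M : Type*) [NormedAddCommGroup E] [NormedSpace ℝ E] [TopologicalSpace M]
    [ChartedSpace E M] : M → Type _ := fun x => TangentSpace 𝓘(ℝ, E) x

instance : SMul (Fn E M) (Sec E F V) :=
  ⟨fun f s => ⟨fun x => f x • s x, f.contMDiff.smul_section s.contMDiff⟩⟩

@[simp] theorem fsmul_apply (f : Fn E M) (s : Sec E F V) (x : M) : (f • s) x = f x • s x := rfl

instance : Module (Fn E M) (Sec E F V) where
  one_smul s := by ext x; exact one_smul ℝ (s x)
  mul_smul f g s := by ext x; exact mul_smul (f x) (g x) (s x)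
  smul_zero f := by ext x; exact smul_zero (f x)
  smul_add f s t := by ext x; exact smul_add (f x) (s x) (t x)
  add_smul f g s := by ext x; exact add_smul (f x) (g x) (s x)
  zero_smul s := by ext x; exact zero_smul ℝ (s x)

/-- A smooth bundle homomorphism applied to a smooth section. -/
def happ (φ : Sec E (F →L[ℝ] F') (HomB V W)) (s : Sec E F V) : Sec E F' W :=
  ⟨fun x => φ x (s x), φ.contMDiff.clm_bundle_apply s.contMDiff⟩

theorem contMDiffAt_trivial_iff (f : M → ℝ) (x : M) :
    ContMDiffAt 𝓘(ℝ, E) (𝓘(ℝ, E).prod 𝓘(ℝ, ℝ)) ∞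
      (fun x => TotalSpace.mk' ℝ (E := Bundle.Trivial M ℝ) x (f x)) x ↔
    ContMDiffAt 𝓘(ℝ, E) 𝓘(ℝ, ℝ) ∞ f x := by
  rw [contMDiffAt_section]
  rfl

/-- The smooth function `⟨α, s⟩`. -/
def pair (α : Sec E (F →L[ℝ] ℝ) (DualB V)) (s : Sec E F V) : Fn E M :=
  ⟨fun x => α x (s x), fun x => (contMDiffAt_trivial_iff _ x).1
    ((ContMDiff.clm_bundle_apply (F₁ := F) (F₂ := ℝ) (E₁ := V) (E₂ := Bundle.Trivial M ℝ)
      α.contMDiff s.contMDiff) x)⟩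

/-- The derivative `X(f)`. -/
def der [IsManifold 𝓘(ℝ, E) ∞ M] (X : Sec E E (TB E M)) (f : Fn E M) : Fn E M :=
  ⟨fun x => mvfderiv 𝓘(ℝ, E) f x (X x), by
    have h1 : ContMDiff 𝓘(ℝ, E).tangent 𝓘(ℝ, ℝ).tangent ∞ (tangentMap 𝓘(ℝ, E) 𝓘(ℝ, ℝ) f) :=
      f.contMDiff.contMDiff_tangentMap (by simp)
    have h2 := h1.comp X.contMDiff
    exact (contMDiff_snd_tangentBundle_modelSpace ℝ 𝓘(ℝ, ℝ)).comp h2⟩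

/-- The Lie bracket of smooth vector fields. -/
def lie [CompleteSpace E] [IsManifold 𝓘(ℝ, E) ∞ M] (X Y : Sec E E (TB E M)) : Sec E E (TB E M) :=
  ⟨VectorField.mlieBracket 𝓘(ℝ, E) X Y,  by
    have : IsManifold 𝓘(ℝ, E) ((⊤ : ℕ∞) + 1) M := by simpa using ‹IsManifold 𝓘(ℝ, E) ∞ M›
    have : IsManifold 𝓘(ℝ, E) (minSmoothness ℝ 2) M :=
      IsManifold.of_le (n := ∞) (by simp [ENat.LEInfty.out])
    exact ContDiff.mlieBracket_vectorField (m := ⊤) (n := ⊤) X.contMDiff Y.contMDiff (by simp)⟩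

end Basic

section Repr

variable {E : Type*} [NormedAddCommGroup E] [NormedSpace ℝ E] [FiniteDimensional ℝ E]
  {M : Type*} [TopologicalSpace M] [ChartedSpace E M] [T2Space M] [IsManifold 𝓘(ℝ, E) ∞ M]
  {F : Type*} [NormedAddCommGroup F] [NormedSpace ℝ F] [FiniteDimensional ℝ F]
  {V : M → Type*} [TopologicalSpace (TotalSpace F V)]
  [∀ x, AddCommGroup (V x)] [∀ x, Module ℝ (V x)] [∀ x, TopologicalSpace (V x)]
  [FiberBundle F V] [VectorBundle ℝ F V] [ContMDiffVectorBundle ∞ F V 𝓘(ℝ, E)]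
  {F' : Type*} [NormedAddCommGroup F'] [NormedSpace ℝ F']
  {W : M → Type*} [TopologicalSpace (TotalSpace F' W)]
  [∀ x, AddCommGroup (W x)] [∀ x, Module ℝ (W x)] [∀ x, TopologicalSpace (W x)]
  [∀ x, IsTopologicalAddGroup (W x)] [∀ x, ContinuousSMul ℝ (W x)]
  [FiberBundle F' W] [VectorBundle ℝ F' W] [ContMDiffVectorBundle ∞ F' W 𝓘(ℝ, E)]

variable (E) in
theorem exists_bump (x : M) {u : Set M} (hu : u ∈ nhds x) :
    ∃ χ : Fn E M, tsupport χ ⊆ u ∧ ∀ᶠ y in nhds x, χ y = 1 := by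
  obtain ⟨f, -, hf⟩ := (SmoothBumpFunction.nhds_basis_tsupport (I := 𝓘(ℝ, E)) x).mem_iff.1 hu
  exact ⟨⟨f, f.contMDiff⟩, hf, f.eventuallyEq_one⟩

variable (E F V) in
/-- A smooth frame near `x`, extended by a cut-off to global sections. -/
theorem exists_frame (x : M) (v : F) : ∃ s : Sec E F V, ∀ᶠ y in nhds x,
    s y = (trivializationAt F V x).symmL ℝ y v := by
  set e := trivializationAt F V x
  have hx : e.baseSet ∈ nhds x := e.open_baseSet.mem_nhds (FiberBundle.mem_baseSet_trivializationAt F V x)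
  obtain ⟨χ, h1, h2⟩ := exists_bump E x hx
  have hs : ContMDiffOn 𝓘(ℝ, E) (𝓘(ℝ, E).prod 𝓘(ℝ, F)) ∞
      (fun y => TotalSpace.mk' F y (e.symmL ℝ y v)) e.baseSet := by
    refine (e.contMDiffOn_section_baseSet_iff).2 ?_
    refine (contMDiffOn_const (c := v)).congr ?_
    intro y hy
    simp [hy]
  refine ⟨⟨fun y => χ y • e.symmL ℝ y v, ContMDiffOn.smul_section_of_tsupport
    χ.contMDiff.contMDiffOn e.open_baseSet h1 hs⟩, ?_⟩
  filter_upwards [h2] with y hy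
  show χ y • e.symmL ℝ y v = _
  rw [hy, one_smul]

/-- A family of fibrewise linear maps is smooth as soon as it maps smooth sections to smooth
sections. -/
theorem contMDiff_hom (φ : ∀ x, HomB V W x)
    (h : ∀ s : Sec E F V, ContMDiff 𝓘(ℝ, E) (𝓘(ℝ, E).prod 𝓘(ℝ, F')) ∞
      (fun x => TotalSpace.mk' F' x (φ x (s x)))) :
    ContMDiff 𝓘(ℝ, E) (𝓘(ℝ, E).prod 𝓘(ℝ, F →L[ℝ] F')) ∞
      (fun x => TotalSpace.mk' (F →L[ℝ] F') (E := HomB V W) x (φ x)) := by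
  intro x
  rw [contMDiffAt_hom_bundle]
  refine ⟨contMDiffAt_id, ?_⟩
  dsimp only
  set A : M → F →L[ℝ] F' := fun y => ContinuousLinearMap.inCoordinates F V F' W x y x y (φ y) with hA
  let b := Module.finBasis ℝ F
  have key : ∀ v : F, ContMDiffAt 𝓘(ℝ, E) 𝓘(ℝ, F') ∞ (fun y => A y v) x := by
    intro v
    obtain ⟨s, hs⟩ := exists_frame E F V x v
    have h1 := (contMDiffAt_section _).1 (h s x)
    refine h1.congr_of_eventuallyEq ?_
    have hW : (trivializationAt F' W x).baseSet ∈ nhds x :=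
      (trivializationAt F' W x).open_baseSet.mem_nhds (FiberBundle.mem_baseSet_trivializationAt F' W x)
    filter_upwards [hs, hW] with y hy hyW
    rw [hy]
    simp [hA, ContinuousLinearMap.inCoordinates, Bundle.Trivialization.linearMapAt_apply, hyW]
  have hsum : A = fun y => ∑ i, (ContinuousLinearMap.smulRightL ℝ F F'
      (LinearMap.toContinuousLinearMap (b.coord i))) (A y (b i)) := by
    funext y
    ext v
    have h1 : A y v = ∑ i, b.repr v i • A y (b i) := by
      have h2 := congrArg (A y) (b.sum_repr v)
      rw [map_sum] at h2
      simpa using h2.symm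
    simpa using h1
  rw [hsum]
  refine ContMDiffAt.sum fun i _ => ?_
  exact (ContinuousLinearMap.contMDiff _).contMDiffAt.comp x (key (b i))

theorem contMDiff_dual (φ : ∀ x, DualB V x)
    (h : ∀ s : Sec E F V, ContMDiff 𝓘(ℝ, E) 𝓘(ℝ, ℝ) ∞ (fun x => (φ x (s x) : ℝ))) :
    ContMDiff 𝓘(ℝ, E) (𝓘(ℝ, E).prod 𝓘(ℝ, F →L[ℝ] ℝ)) ∞
      (fun x => TotalSpace.mk' (F →L[ℝ] ℝ) (E := DualB V) x (φ x)) :=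
  contMDiff_hom (W := Bundle.Trivial M ℝ) φ
    fun s x => (contMDiffAt_trivial_iff _ x).2 (h s x)


/-- A local coordinate of a section, multiplied by a cut-off. -/
theorem contMDiff_coord (x : M) (χ : Fn E M)
    (hχ : tsupport χ ⊆ (trivializationAt F V x).baseSet) (l : F →L[ℝ] ℝ) (s : Sec E F V) :
    ContMDiff 𝓘(ℝ, E) 𝓘(ℝ, ℝ) ∞
      (fun y => χ y * l ((trivializationAt F V x).continuousLinearMapAt ℝ y (s y))) := by
  set e := trivializationAt F V x
  have h1 : ContMDiffOn 𝓘(ℝ, E) 𝓘(ℝ, F) ∞ (fun y => (e ⟨y, s y⟩).2) e.baseSet :=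
    (e.contMDiffOn_section_baseSet_iff).1 s.contMDiff.contMDiffOn
  refine contMDiff_of_tsupport fun y hy => ?_
  have hy' : y ∈ e.baseSet := hχ (tsupport_smul_subset_left (f := χ) (g := fun y =>
    l (e.continuousLinearMapAt ℝ y (s y))) hy)
  have hb : e.baseSet ∈ nhds y := e.open_baseSet.mem_nhds hy'
  refine χ.contMDiff.contMDiffAt.mul ?_
  have h2 := l.contMDiff.contMDiffAt.comp (I' := 𝓘(ℝ, F)) y (h1.contMDiffAt hb)
  refine h2.congr_of_eventuallyEq ?_
  filter_upwards [hb] with z hz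
  show l (e.continuousLinearMapAt ℝ z (s z)) = l (e ⟨z, s z⟩).2
  rw [Bundle.Trivialization.continuousLinearMapAt_apply,
    Bundle.Trivialization.linearMapAt_apply, if_pos hz]

theorem contMDiff_of_pair (σ : ∀ x, V x)
    (h : ∀ η : Sec E (F →L[ℝ] ℝ) (DualB V),
      ContMDiff 𝓘(ℝ, E) 𝓘(ℝ, ℝ) ∞ (fun x => (η x (σ x) : ℝ))) :
    ContMDiff 𝓘(ℝ, E) (𝓘(ℝ, E).prod 𝓘(ℝ, F)) ∞ (fun x => TotalSpace.mk' F x (σ x)) := by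
  intro x
  rw [contMDiffAt_section]
  set e := trivializationAt F V x with he
  have hx : e.baseSet ∈ nhds x :=
    e.open_baseSet.mem_nhds (FiberBundle.mem_baseSet_trivializationAt F V x)
  let b := Module.finBasis ℝ F
  obtain ⟨χ, h1, h2⟩ := exists_bump E x hx
  have key : ∀ i, ContMDiffAt 𝓘(ℝ, E) 𝓘(ℝ, ℝ) ∞ (fun y => b.coord i (e ⟨y, σ y⟩).2) x := by
    intro i
    let l : F →L[ℝ] ℝ := LinearMap.toContinuousLinearMap (b.coord i)
    let φ : ∀ y, DualB V y := fun y => χ y • (l ∘L (e.continuousLinearMapAt ℝ y))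
    let η : Sec E (F →L[ℝ] ℝ) (DualB V) :=
      ⟨φ, contMDiff_dual φ fun s => contMDiff_coord x χ h1 l s⟩
    refine (h η x).congr_of_eventuallyEq ?_
    filter_upwards [h2, hx] with y hy hyx
    show _ = χ y * l (e.continuousLinearMapAt ℝ y (σ y))
    rw [hy]
    simp [l, Bundle.Trivialization.linearMapAt_apply, hyx]
  have hsum : (fun y => (e ⟨y, σ y⟩).2) = fun y => ∑ i, b.coord i (e ⟨y, σ y⟩).2 • b i := by
    funext y
    exact (b.sum_repr _).symm
  rw [hsum]
  exact ContMDiffAt.sum fun i _ => (key i).smul contMDiffAt_const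

variable (E F) in
theorem exists_sec (x : M) (v : V x) : ∃ s : Sec E F V, s x = v := by
  obtain ⟨s, hs⟩ := exists_frame E F V x ((trivializationAt F V x).continuousLinearMapAt ℝ x v)
  refine ⟨s, hs.self_of_nhds.trans ?_⟩
  exact (trivializationAt F V x).symmL_continuousLinearMapAt
    (FiberBundle.mem_baseSet_trivializationAt F V x) v

/-- A `C^∞(M)`-linear functional on sections is pointwise. -/
theorem apply_eq_zero (L : Sec E F V →ₗ[Fn E M] Fn E M) (s : Sec E F V) (x : M) (hs : s x = 0) :
    L s x = 0 := by
  set e := trivializationAt F V x with he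
  have hx : e.baseSet ∈ nhds x :=
    e.open_baseSet.mem_nhds (FiberBundle.mem_baseSet_trivializationAt F V x)
  let b := Module.finBasis ℝ F
  obtain ⟨χ, h1, h2⟩ := exists_bump E x hx
  let l (i) : F →L[ℝ] ℝ := LinearMap.toContinuousLinearMap (b.coord i)
  let c (i) : Fn E M := ⟨_, contMDiff_coord x χ h1 (l i) s⟩
  have ht (i) : ContMDiffOn 𝓘(ℝ, E) (𝓘(ℝ, E).prod 𝓘(ℝ, F)) ∞
      (fun y => TotalSpace.mk' F y (e.symmL ℝ y (b i))) e.baseSet := by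
    refine (e.contMDiffOn_section_baseSet_iff).2 ?_
    refine (contMDiffOn_const (c := b i)).congr ?_
    intro y hy
    simp [hy]
  let t (i) : Sec E F V := ⟨fun y => χ y • e.symmL ℝ y (b i),
    ContMDiffOn.smul_section_of_tsupport χ.contMDiff.contMDiffOn e.open_baseSet h1 (ht i)⟩
  have hsum : (χ * χ) • s = ∑ i, c i • t i := by
    ext y
    have h3 : (∑ i, c i • t i) y = ∑ i, (c i • t i) y := by
      have := map_sum ((Pi.evalAddMonoidHom _ y).comp (ContMDiffSection.coeAddHom 𝓘(ℝ, E) F ∞ V))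
        (fun i => c i • t i) Finset.univ
      exact this
    rw [h3]
    show (χ y * χ y) • s y = ∑ i, (χ y * l i (e.continuousLinearMapAt ℝ y (s y))) •
      (χ y • e.symmL ℝ y (b i))
    by_cases hy : y ∈ e.baseSet
    · have h5 : s y = ∑ i, l i (e.continuousLinearMapAt ℝ y (s y)) • e.symmL ℝ y (b i) := by
        have h6 := congrArg (e.symmL ℝ y) (b.sum_repr (e.continuousLinearMapAt ℝ y (s y)))
        rw [e.symmL_continuousLinearMapAt hy, map_sum] at h6
        exact h6.symm.trans (Finset.sum_congr rfl fun i _ => by rw [map_smul]; rfl)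
      conv_lhs => rw [h5]
      rw [Finset.smul_sum]
      refine Finset.sum_congr rfl fun i _ => ?_
      simp only [smul_smul]
      congr 1
      ring
    · have : χ y = 0 := image_eq_zero_of_notMem_tsupport fun h => hy (h1 h)
      simp [this]
  have hc : ∀ i, c i x = 0 := fun i => by
    show χ x * _ = 0
    rw [hs]; simp
  have h4 := congrArg (fun g => L g x) hsum
  simp only [map_smul, map_sum] at h4
  have h7 : (∑ i, c i • L (t i)) x = ∑ i, c i x * L (t i) x := by
    have := map_sum ((Pi.evalAddMonoidHom _ x).comp
      (ContMDiffMap.coeFnAddMonoidHom (I := 𝓘(ℝ, E)) (I' := 𝓘(ℝ, ℝ)) (N := M) (G := ℝ) (n := ∞)))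
      (fun i => c i • L (t i)) Finset.univ
    exact this
  rw [h7] at h4
  have h8 : ((χ * χ) • L s) x = χ x * χ x * L s x := rfl
  rw [h8, h2.self_of_nhds] at h4
  simpa [hc] using h4

theorem apply_congr (L : Sec E F V →ₗ[Fn E M] Fn E M) (s t : Sec E F V) (x : M) (h : s x = t x) :
    L s x = L t x := by
  have h1 := apply_eq_zero L (s - t) x (by simp [h])
  rw [map_sub] at h1
  exact sub_eq_zero.1 h1

/-- The value at `x` of the `1`-form attached to a `C^∞(M)`-linear functional. -/
def pointLin (L : Sec E F V →ₗ[Fn E M] Fn E M) (x : M) : V x →ₗ[ℝ] ℝ where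
  toFun v := L (exists_sec E F x v).choose x
  map_add' v w := by
    have h : (L (exists_sec E F x v).choose + L (exists_sec E F x w).choose) x
      = L (exists_sec E F x v).choose x + L (exists_sec E F x w).choose x := rfl
    rw [← h, ← map_add]
    refine apply_congr L _ _ x ?_
    rw [(exists_sec E F x (v + w)).choose_spec, ContMDiffSection.coe_add, Pi.add_apply,
      (exists_sec E F x v).choose_spec, (exists_sec E F x w).choose_spec]
  map_smul' c v := by
    let f : Fn E M := ContMDiffMap.const c
    have h : (f • L (exists_sec E F x v).choose) x
      = c * L (exists_sec E F x v).choose x := rfl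
    rw [RingHom.id_apply, smul_eq_mul, ← h, ← map_smul]
    refine apply_congr L _ _ x ?_
    rw [(exists_sec E F x (c • v)).choose_spec, fsmul_apply, (exists_sec E F x v).choose_spec]
    rfl

theorem pointLin_apply (L : Sec E F V →ₗ[Fn E M] Fn E M) (x : M) (s : Sec E F V) :
    pointLin L x (s x) = L s x :=
  apply_congr L _ _ x (exists_sec E F x (s x)).choose_spec

/-- A `C^∞(M)`-linear functional on the sections of `V` is a section of the dual bundle. -/
theorem exists_form (L : Sec E F V →ₗ[Fn E M] Fn E M) :
    ∃ α : Sec E (F →L[ℝ] ℝ) (DualB V), ∀ s, pair α s = L s := by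
  have hp : ∀ x, ∃ φ : DualB V x, ∀ v, φ v = pointLin L x v := by
    intro x
    have : T2Space (V x) := FiberBundle.t2Space F V x
    have : FiniteDimensional ℝ (V x) := VectorBundle.finiteDimensional ℝ F V x
    have : IsTopologicalAddGroup (V x) :=
      (VectorBundle.continuousLinearEquivAt ℝ F V x).toContinuousAddEquiv.isTopologicalAddGroup
    have : ContinuousSMul ℝ (V x) :=
      (VectorBundle.continuousLinearEquivAt ℝ F V x).continuousSMul
    exact ⟨LinearMap.toContinuousLinearMap (pointLin L x), fun v => rfl⟩
  choose φ hφ using hp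
  refine ⟨⟨φ, contMDiff_dual φ fun s => ?_⟩, fun s => ?_⟩
  · simp only [hφ, pointLin_apply]
    exact (L s).contMDiff
  · ext x
    exact (hφ x (s x)).trans (pointLin_apply L x s)

theorem form_ext {α β : Sec E (F →L[ℝ] ℝ) (DualB V)} (h : ∀ s, pair α s = pair β s) : α = β := by
  refine ContMDiffSection.ext fun x => ContinuousLinearMap.ext fun v => ?_
  obtain ⟨s, rfl⟩ := exists_sec E F x v
  exact congrArg (fun f : Fn E M => f x) (h s)

/-- A `C^∞(M)`-linear functional on the sections of the dual of `V` is a section of `V`. -/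
theorem exists_section (L : Sec E (F →L[ℝ] ℝ) (DualB V) →ₗ[Fn E M] Fn E M) :
    ∃ s : Sec E F V, ∀ α, pair α s = L α := by
  have hp : ∀ x, ∃ v : V x, ∀ φ : DualB V x, φ v = pointLin L x φ := by
    intro x
    have : T2Space (V x) := FiberBundle.t2Space F V x
    have : FiniteDimensional ℝ (V x) := VectorBundle.finiteDimensional ℝ F V x
    have : IsTopologicalAddGroup (V x) :=
      (VectorBundle.continuousLinearEquivAt ℝ F V x).toContinuousAddEquiv.isTopologicalAddGroup
    have : ContinuousSMul ℝ (V x) :=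
      (VectorBundle.continuousLinearEquivAt ℝ F V x).continuousSMul
    let m : Module.Dual ℝ (V x) →ₗ[ℝ] ℝ :=
      (pointLin L x).comp (LinearMap.toContinuousLinearMap (E := V x) (F' := ℝ)).toLinearMap
    refine ⟨(Module.evalEquiv ℝ (V x)).symm m, fun φ => ?_⟩
    have h1 := Module.apply_evalEquiv_symm_apply ℝ (V x) φ.toLinearMap m
    refine Eq.trans h1 ?_
    show pointLin L x _ = _
    congr 1
  choose σ hσ using hp
  refine ⟨⟨σ, contMDiff_of_pair σ fun η => ?_⟩, fun α => ?_⟩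
  · simp only [hσ, pointLin_apply]
    exact (L η).contMDiff
  · ext x
    exact (hσ x (α x)).trans (pointLin_apply L x α)

theorem section_ext {s t : Sec E F V}
    (h : ∀ α : Sec E (F →L[ℝ] ℝ) (DualB V), pair α s = pair α t) : s = t := by
  ext x
  have : T2Space (V x) := FiberBundle.t2Space F V x
  have : FiniteDimensional ℝ (V x) := VectorBundle.finiteDimensional ℝ F V x
  have : IsTopologicalAddGroup (V x) :=
    (VectorBundle.continuousLinearEquivAt ℝ F V x).toContinuousAddEquiv.isTopologicalAddGroup
  have : ContinuousSMul ℝ (V x) :=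
    (VectorBundle.continuousLinearEquivAt ℝ F V x).continuousSMul
  rw [← sub_eq_zero, ← Module.forall_dual_apply_eq_zero_iff ℝ]
  intro l
  obtain ⟨α, hα⟩ := exists_sec E (F →L[ℝ] ℝ) (V := DualB V) x
    (LinearMap.toContinuousLinearMap (F' := ℝ) l)
  have h1 : ∀ s : Sec E F V, pair α s x = l (s x) := fun s =>
    congrArg (fun φ : DualB V x => φ (s x)) hα
  rw [map_sub, ← h1, ← h1, h α, sub_self]

end Repr

section Calculus

variable {E : Type*} [NormedAddCommGroup E] [NormedSpace ℝ E]
  {M : Type*} [TopologicalSpace M] [ChartedSpace E M] [IsManifold 𝓘(ℝ, E) ∞ M]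

theorem der_add_left (X Y : Sec E E (TB E M)) (f : Fn E M) : der (X + Y) f = der X f + der Y f := by
  ext x; exact map_add (mvfderiv 𝓘(ℝ, E) f x) (X x) (Y x)

theorem der_fsmul_left (g : Fn E M) (X : Sec E E (TB E M)) (f : Fn E M) :
    der (g • X) f = g * der X f := by
  ext x; exact map_smul (mvfderiv 𝓘(ℝ, E) f x) (g x) (X x)

theorem mdiffAt (f : Fn E M) (x : M) : MDifferentiableAt 𝓘(ℝ, E) 𝓘(ℝ, ℝ) f x :=
  f.contMDiff.mdifferentiable (by simp) x

theorem der_add (X : Sec E E (TB E M)) (f g : Fn E M) : der X (f + g) = der X f + der X g := by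
  ext x
  exact congrArg (fun l => l (X x)) (mvfderiv_add (mdiffAt f x) (mdiffAt g x))

theorem der_mul (X : Sec E E (TB E M)) (f g : Fn E M) :
    der X (f * g) = f * der X g + der X f * g := by
  ext x
  refine (congrArg (fun l => l (X x)) (mvfderiv_mul (mdiffAt f x) (mdiffAt g x))).trans ?_
  show f x * _ + g x * _ = f x * _ + _ * g x
  rw [mul_comm (g x)]
  rfl

theorem der_const (X : Sec E E (TB E M)) (c : ℝ) :
    der X (ContMDiffMap.const c : Fn E M) = 0 := by
  ext x
  exact congrArg (fun l => l (X x)) (mvfderiv_const (I := 𝓘(ℝ, E)) (x := x) c)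

end Calculus

section Pairing

variable {E : Type*} [NormedAddCommGroup E] [NormedSpace ℝ E]
  {M : Type*} [TopologicalSpace M] [ChartedSpace E M]
  {F : Type*} [NormedAddCommGroup F] [NormedSpace ℝ F]
  {V : M → Type*} [TopologicalSpace (TotalSpace F V)]
  [∀ x, AddCommGroup (V x)] [∀ x, Module ℝ (V x)] [∀ x, TopologicalSpace (V x)]
  [FiberBundle F V] [VectorBundle ℝ F V]
  {F' : Type*} [NormedAddCommGroup F'] [NormedSpace ℝ F']
  {W : M → Type*} [TopologicalSpace (TotalSpace F' W)]
  [∀ x, AddCommGroup (W x)] [∀ x, Module ℝ (W x)] [∀ x, TopologicalSpace (W x)]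
  [∀ x, IsTopologicalAddGroup (W x)] [∀ x, ContinuousSMul ℝ (W x)]
  [FiberBundle F' W] [VectorBundle ℝ F' W]

theorem pair_add (α : Sec E (F →L[ℝ] ℝ) (DualB V)) (s t : Sec E F V) :
    pair α (s + t) = pair α s + pair α t := by
  ext x; exact map_add (α x) (s x) (t x)

theorem pair_fsmul (f : Fn E M) (α : Sec E (F →L[ℝ] ℝ) (DualB V)) (s : Sec E F V) :
    pair α (f • s) = f * pair α s := by
  ext x; exact map_smul (α x) (f x) (s x)

theorem add_pair (α β : Sec E (F →L[ℝ] ℝ) (DualB V)) (s : Sec E F V) :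
    pair (α + β) s = pair α s + pair β s := rfl

theorem fsmul_pair (f : Fn E M) (α : Sec E (F →L[ℝ] ℝ) (DualB V)) (s : Sec E F V) :
    pair (f • α) s = f * pair α s := rfl

theorem happ_add (φ : Sec E (F →L[ℝ] F') (HomB V W)) (s t : Sec E F V) :
    happ φ (s + t) = happ φ s + happ φ t := by
  ext x; exact map_add (φ x) (s x) (t x)

theorem happ_fsmul (φ : Sec E (F →L[ℝ] F') (HomB V W)) (f : Fn E M) (s : Sec E F V) :
    happ φ (f • s) = f • happ φ s := by
  ext x; exact map_smul (φ x) (f x) (s x)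

end Pairing

section Connections

variable {E : Type*} [NormedAddCommGroup E] [NormedSpace ℝ E]
  {M : Type*} [TopologicalSpace M] [ChartedSpace E M] [IsManifold 𝓘(ℝ, E) ∞ M]
  {F : Type*} [NormedAddCommGroup F] [NormedSpace ℝ F]
  {V : M → Type*} [TopologicalSpace (TotalSpace F V)]
  [∀ x, AddCommGroup (V x)] [∀ x, Module ℝ (V x)] [∀ x, TopologicalSpace (V x)]
  [FiberBundle F V] [VectorBundle ℝ F V]
  {F' : Type*} [NormedAddCommGroup F'] [NormedSpace ℝ F']
  {W : M → Type*} [TopologicalSpace (TotalSpace F' W)]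
  [∀ x, AddCommGroup (W x)] [∀ x, Module ℝ (W x)] [∀ x, TopologicalSpace (W x)]
  [FiberBundle F' W] [VectorBundle ℝ F' W]

/-- An anchor on the vector bundle `V`: a smooth bundle homomorphism `V → TM`. -/
abbrev Anchor (E F : Type*) [NormedAddCommGroup E] [NormedSpace ℝ E]
    [NormedAddCommGroup F] [NormedSpace ℝ F]
    {M : Type*} [TopologicalSpace M] [ChartedSpace E M] [IsManifold 𝓘(ℝ, E) ∞ M]
    (V : M → Type*) [TopologicalSpace (TotalSpace F V)]
    [∀ x, AddCommGroup (V x)] [∀ x, Module ℝ (V x)]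
    [∀ x, TopologicalSpace (V x)] [FiberBundle F V] [VectorBundle ℝ F V] :=
  Sec E (F →L[ℝ] E) (HomB V (TB E M))

/-- A `V`-connection on the vector bundle `W`, where `V` carries the anchor `ρ`.
(`ℝ`-bilinearity is the case of constant functions in the last two fields.) -/
structure AConn (ρ : Anchor E F V) (F' : Type*) [NormedAddCommGroup F'] [NormedSpace ℝ F']
    (W : M → Type*) [TopologicalSpace (TotalSpace F' W)]
    [∀ x, AddCommGroup (W x)] [∀ x, Module ℝ (W x)] [∀ x, TopologicalSpace (W x)]
    [FiberBundle F' W] [VectorBundle ℝ F' W] where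
  /-- `conn a s` is `∇_a s`. -/
  conn : Sec E F V → Sec E F' W → Sec E F' W
  add_left : ∀ a b s, conn (a + b) s = conn a s + conn b s
  add_right : ∀ a s t, conn a (s + t) = conn a s + conn a t
  fsmul_left : ∀ (f : Fn E M) a s, conn (f • a) s = f • conn a s
  leibniz : ∀ (f : Fn E M) a s, conn a (f • s) = f • conn a s + der (happ ρ a) f • s

/-- A right-anchored product on the anchored bundle `(V, ρ)`. -/
abbrev RAProduct (ρ : Anchor E F V) := AConn ρ F V

/-- The anchored bracket `[a, b]_T = T_a b - T_b a`. -/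
def RAProduct.bracket {ρ : Anchor E F V} (T : RAProduct ρ) (a b : Sec E F V) : Sec E F V :=
  T.conn a b - T.conn b a

/-- The curvature `R^T(a, b) c = [T_a, T_b] c - T_{[a, b]_T} c`. -/
def RAProduct.curv {ρ : Anchor E F V} (T : RAProduct ρ) (a b c : Sec E F V) : Sec E F V :=
  T.conn a (T.conn b c) - T.conn b (T.conn a c) - T.conn (T.bracket a b) c

/-- `(V, M, ρ, T)` is a left symmetric algebroid. -/
def RAProduct.IsLeftSymmetric {ρ : Anchor E F V} (T : RAProduct ρ) : Prop :=
  ∀ a b c, T.curv a b c = 0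

end Connections

section Dual

variable {E : Type*} [NormedAddCommGroup E] [NormedSpace ℝ E] [FiniteDimensional ℝ E]
  {M : Type*} [TopologicalSpace M] [ChartedSpace E M] [T2Space M] [IsManifold 𝓘(ℝ, E) ∞ M]
  {F : Type*} [NormedAddCommGroup F] [NormedSpace ℝ F]
  {V : M → Type*} [TopologicalSpace (TotalSpace F V)]
  [∀ x, AddCommGroup (V x)] [∀ x, Module ℝ (V x)] [∀ x, TopologicalSpace (V x)]
  [FiberBundle F V] [VectorBundle ℝ F V]
  {F' : Type*} [NormedAddCommGroup F'] [NormedSpace ℝ F'] [FiniteDimensional ℝ F']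
  {W : M → Type*} [TopologicalSpace (TotalSpace F' W)]
  [∀ x, AddCommGroup (W x)] [∀ x, Module ℝ (W x)] [∀ x, TopologicalSpace (W x)]
  [FiberBundle F' W] [VectorBundle ℝ F' W] [ContMDiffVectorBundle ∞ F' W 𝓘(ℝ, E)]
  {ρ : Anchor E F V}

theorem AConn.exists_dual (D : AConn ρ F' W) (a : Sec E F V)
    (α : Sec E (F' →L[ℝ] ℝ) (DualB W)) :
    ∃ β : Sec E (F' →L[ℝ] ℝ) (DualB W), ∀ s,
      pair β s = der (happ ρ a) (pair α s) - pair α (D.conn a s) :=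
  exists_form
    { toFun := fun s => der (happ ρ a) (pair α s) - pair α (D.conn a s)
      map_add' := fun s t => by
        rw [pair_add, der_add, D.add_right, pair_add]; ring
      map_smul' := fun f s => by
        rw [pair_fsmul, der_mul, D.leibniz, pair_add, pair_fsmul, pair_fsmul, RingHom.id_apply,
          smul_eq_mul]
        ring }

theorem AConn.exists_predual (D : AConn ρ (F' →L[ℝ] ℝ) (DualB W)) (a : Sec E F V)
    (s : Sec E F' W) :
    ∃ t : Sec E F' W, ∀ α,
      pair α t = der (happ ρ a) (pair α s) - pair (D.conn a α) s :=
  exists_section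
    { toFun := fun α => der (happ ρ a) (pair α s) - pair (D.conn a α) s
      map_add' := fun α β => by
        rw [add_pair, der_add, D.add_right, add_pair]; ring
      map_smul' := fun f α => by
        rw [fsmul_pair, der_mul, D.leibniz, add_pair, fsmul_pair, fsmul_pair, RingHom.id_apply,
          smul_eq_mul]
        ring }

/-- The dual connection: `⟨∇*_a α, s⟩ = ρ(a).⟨α, s⟩ - ⟨α, ∇_a s⟩`. -/
def AConn.dual (D : AConn ρ F' W) : AConn ρ (F' →L[ℝ] ℝ) (DualB W) where
  conn a α := (D.exists_dual a α).choose
  add_left a b α := form_ext fun s => by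
    rw [add_pair, (D.exists_dual _ α).choose_spec, (D.exists_dual _ α).choose_spec,
      (D.exists_dual _ α).choose_spec, happ_add, der_add_left, D.add_left, pair_add]; ring
  add_right a α β := form_ext fun s => by
    rw [add_pair, (D.exists_dual a _).choose_spec, (D.exists_dual a _).choose_spec,
      (D.exists_dual a _).choose_spec, add_pair, der_add, add_pair]; ring
  fsmul_left f a α := form_ext fun s => by
    rw [fsmul_pair, (D.exists_dual _ α).choose_spec, (D.exists_dual _ α).choose_spec,
      happ_fsmul, der_fsmul_left, D.fsmul_left, pair_fsmul]; ring
  leibniz f a α := form_ext fun s => by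
    rw [add_pair, fsmul_pair, fsmul_pair, (D.exists_dual a _).choose_spec,
      (D.exists_dual a _).choose_spec, fsmul_pair, der_mul, fsmul_pair]; ring

theorem AConn.pair_dual (D : AConn ρ F' W) (a : Sec E F V) (α : Sec E (F' →L[ℝ] ℝ) (DualB W))
    (s : Sec E F' W) :
    pair (D.dual.conn a α) s = der (happ ρ a) (pair α s) - pair α (D.conn a s) :=
  (D.exists_dual a α).choose_spec s

/-- The dual of a connection on `W*`, seen as a connection on `W = W**`:
`⟨α, ∇*_a s⟩ = ρ(a).⟨α, s⟩ - ⟨∇_a α, s⟩`. -/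
def AConn.predual (D : AConn ρ (F' →L[ℝ] ℝ) (DualB W)) : AConn ρ F' W where
  conn a s := (D.exists_predual a s).choose
  add_left a b s := section_ext fun α => by
    rw [pair_add, (D.exists_predual _ s).choose_spec, (D.exists_predual _ s).choose_spec,
      (D.exists_predual _ s).choose_spec, happ_add, der_add_left, D.add_left, add_pair]; ring
  add_right a s t := section_ext fun α => by
    rw [pair_add, (D.exists_predual a _).choose_spec, (D.exists_predual a _).choose_spec,
      (D.exists_predual a _).choose_spec, pair_add, der_add, pair_add]; ring
  fsmul_left f a s := section_ext fun α => by
    rw [pair_fsmul, (D.exists_predual _ s).choose_spec, (D.exists_predual _ s).choose_spec,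
      happ_fsmul, der_fsmul_left, D.fsmul_left, fsmul_pair]; ring
  leibniz f a s := section_ext fun α => by
    rw [pair_add, pair_fsmul, pair_fsmul, (D.exists_predual a _).choose_spec,
      (D.exists_predual a _).choose_spec, pair_fsmul, der_mul, pair_fsmul]; ring

theorem AConn.pair_predual (D : AConn ρ (F' →L[ℝ] ℝ) (DualB W)) (a : Sec E F V)
    (s : Sec E F' W) (α : Sec E (F' →L[ℝ] ℝ) (DualB W)) :
    pair α (D.predual.conn a s) = der (happ ρ a) (pair α s) - pair (D.conn a α) s :=
  (D.exists_predual a s).choose_spec α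

end Dual

section Sharp

variable {E : Type*} [NormedAddCommGroup E] [NormedSpace ℝ E] [FiniteDimensional ℝ E]
  {M : Type*} [TopologicalSpace M] [ChartedSpace E M] [T2Space M] [IsManifold 𝓘(ℝ, E) ∞ M]
  {F : Type*} [NormedAddCommGroup F] [NormedSpace ℝ F] [FiniteDimensional ℝ F]
  {V : M → Type*} [TopologicalSpace (TotalSpace F V)]
  [∀ x, AddCommGroup (V x)] [∀ x, Module ℝ (V x)] [∀ x, TopologicalSpace (V x)]
  [FiberBundle F V] [VectorBundle ℝ F V] [ContMDiffVectorBundle ∞ F V 𝓘(ℝ, E)]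
  {F' : Type*} [NormedAddCommGroup F'] [NormedSpace ℝ F'] [FiniteDimensional ℝ F']
  {W : M → Type*} [TopologicalSpace (TotalSpace F' W)]
  [∀ x, AddCommGroup (W x)] [∀ x, Module ℝ (W x)] [∀ x, TopologicalSpace (W x)]
  [∀ x, IsTopologicalAddGroup (W x)] [∀ x, ContinuousSMul ℝ (W x)]
  [FiberBundle F' W] [VectorBundle ℝ F' W] [ContMDiffVectorBundle ∞ F' W 𝓘(ℝ, E)]

/-- Smooth fields of bilinear forms on the fibres of `V`, i.e. sections of `V* ⊗ V*`. -/
abbrev Bil (E F : Type*) [NormedAddCommGroup E] [NormedSpace ℝ E]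
    [NormedAddCommGroup F] [NormedSpace ℝ F]
    {M : Type*} [TopologicalSpace M] [ChartedSpace E M]
    (V : M → Type*) [TopologicalSpace (TotalSpace F V)]
    [∀ x, AddCommGroup (V x)] [∀ x, Module ℝ (V x)]
    [∀ x, TopologicalSpace (V x)] [FiberBundle F V] [VectorBundle ℝ F V] :=
  Sec E (F →L[ℝ] F →L[ℝ] ℝ) (HomB V (DualB V))

/-- The smooth function `g(a, b)`. -/
def bil (g : Bil E F V) (a b : Sec E F V) : Fn E M := pair (happ g a) b

theorem value_congr (Φ : Sec E F V →ₗ[Fn E M] Sec E F' W) (s t : Sec E F V) (x : M)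
    (h : s x = t x) : Φ s x = Φ t x := by
  have hT : T2Space (W x) := FiberBundle.t2Space F' W x
  have : FiniteDimensional ℝ (W x) := VectorBundle.finiteDimensional ℝ F' W x
  rw [← sub_eq_zero, ← Module.forall_dual_apply_eq_zero_iff ℝ]
  intro l
  obtain ⟨α, hα⟩ := exists_sec E (F' →L[ℝ] ℝ) (V := DualB W) x
    (LinearMap.toContinuousLinearMap (F' := ℝ) l)
  have h1 : ∀ s : Sec E F' W, pair α s x = l (s x) := fun s =>
    congrArg (fun φ : DualB W x => φ (s x)) hα
  let L : Sec E F V →ₗ[Fn E M] Fn E M :=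
    { toFun := fun s => pair α (Φ s)
      map_add' := fun s t => by rw [map_add, pair_add]
      map_smul' := fun f s => by rw [map_smul, pair_fsmul]; rfl }
  have h2 : pair α (Φ s) x = pair α (Φ t) x := apply_congr L s t x h
  rw [map_sub, ← h1, ← h1, h2, sub_self]

/-- A `C^∞(M)`-linear map between spaces of sections is a smooth bundle homomorphism. -/
theorem exists_hom (Φ : Sec E F V →ₗ[Fn E M] Sec E F' W) :
    ∃ φ : Sec E (F →L[ℝ] F') (HomB V W), ∀ s, happ φ s = Φ s := by
  have hp : ∀ x, ∃ φ : HomB V W x, ∀ s, φ (s x) = Φ s x := by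
    intro x
    have : T2Space (V x) := FiberBundle.t2Space F V x
    have : FiniteDimensional ℝ (V x) := VectorBundle.finiteDimensional ℝ F V x
    have : IsTopologicalAddGroup (V x) :=
      (VectorBundle.continuousLinearEquivAt ℝ F V x).toContinuousAddEquiv.isTopologicalAddGroup
    have : ContinuousSMul ℝ (V x) :=
      (VectorBundle.continuousLinearEquivAt ℝ F V x).continuousSMul
    let l : V x →ₗ[ℝ] W x :=
      { toFun := fun v => Φ (exists_sec E F x v).choose x
        map_add' := fun v w => by
          rw [← Pi.add_apply, ← ContMDiffSection.coe_add, ← map_add]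
          refine value_congr Φ _ _ x ?_
          rw [(exists_sec E F x (v + w)).choose_spec, ContMDiffSection.coe_add, Pi.add_apply,
            (exists_sec E F x v).choose_spec, (exists_sec E F x w).choose_spec]
        map_smul' := fun c v => by
          have h : ((ContMDiffMap.const c : Fn E M) • Φ (exists_sec E F x v).choose) x
            = c • Φ (exists_sec E F x v).choose x := rfl
          rw [RingHom.id_apply, ← h, ← map_smul]
          refine value_congr Φ _ _ x ?_
          rw [(exists_sec E F x (c • v)).choose_spec, fsmul_apply,
            (exists_sec E F x v).choose_spec]
          rfl }
    exact ⟨LinearMap.toContinuousLinearMap l, fun s =>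
      value_congr Φ _ _ x (exists_sec E F x (s x)).choose_spec⟩
  choose φ hφ using hp
  refine ⟨⟨φ, contMDiff_hom φ fun s => ?_⟩, fun s => ?_⟩
  · simp only [hφ]
    exact (Φ s).contMDiff
  · ext x
    exact hφ x s

theorem exists_sharp [∀ x, IsTopologicalAddGroup (V x)] [∀ x, ContinuousSMul ℝ (V x)]
    (r : Bil E (F →L[ℝ] ℝ) (DualB V)) :
    ∃ φ : Sec E ((F →L[ℝ] ℝ) →L[ℝ] F) (HomB (DualB V) V),
      ∀ α β, pair β (happ φ α) = bil r α β := by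
  have h1 : ∀ α, ∃ s : Sec E F V, ∀ β, pair β s = bil r α β := fun α =>
    exists_section
      { toFun := fun β => bil r α β
        map_add' := fun β γ => pair_add _ _ _
        map_smul' := fun f β => pair_fsmul _ _ _ }
  choose Φ hΦ using h1
  obtain ⟨φ, hφ⟩ := exists_hom (E := E) (V := DualB V) (W := V)
    { toFun := Φ
      map_add' := fun α β => section_ext fun γ => by
        rw [pair_add, hΦ, hΦ, hΦ, bil, happ_add, add_pair]; rfl
      map_smul' := fun f α => section_ext fun γ => by
        rw [RingHom.id_apply, pair_fsmul, hΦ, hΦ, bil, happ_fsmul, fsmul_pair]; rfl }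
  exact ⟨φ, fun α β => by rw [hφ]; exact hΦ α β⟩

/-- The bundle homomorphism `r_# : V* → V` with `⟨β, r_# α⟩ = r(α, β)`. -/
def sharp [∀ x, IsTopologicalAddGroup (V x)] [∀ x, ContinuousSMul ℝ (V x)]
    (r : Bil E (F →L[ℝ] ℝ) (DualB V)) : Sec E ((F →L[ℝ] ℝ) →L[ℝ] F) (HomB (DualB V) V) :=
  (exists_sharp r).choose

theorem pair_sharp [∀ x, IsTopologicalAddGroup (V x)] [∀ x, ContinuousSMul ℝ (V x)]
    (r : Bil E (F →L[ℝ] ℝ) (DualB V)) (α β : Sec E (F →L[ℝ] ℝ) (DualB V)) :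
    pair β (happ (sharp r) α) = bil r α β :=
  (exists_sharp r).choose_spec α β

end Sharp

section Sum

variable {E : Type*} [NormedAddCommGroup E] [NormedSpace ℝ E]
  {M : Type*} [TopologicalSpace M] [ChartedSpace E M]
  {F : Type*} [NormedAddCommGroup F] [NormedSpace ℝ F]
  {V : M → Type*} [TopologicalSpace (TotalSpace F V)]
  [∀ x, AddCommGroup (V x)] [∀ x, Module ℝ (V x)] [∀ x, TopologicalSpace (V x)]
  [FiberBundle F V] [VectorBundle ℝ F V]
  {F' : Type*} [NormedAddCommGroup F'] [NormedSpace ℝ F']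
  {W : M → Type*} [TopologicalSpace (TotalSpace F' W)]
  [∀ x, AddCommGroup (W x)] [∀ x, Module ℝ (W x)] [∀ x, TopologicalSpace (W x)]
  [FiberBundle F' W] [VectorBundle ℝ F' W]

theorem contMDiff_sum_iff (s : ∀ x, V x) (t : ∀ x, W x) :
    ContMDiff 𝓘(ℝ, E) (𝓘(ℝ, E).prod 𝓘(ℝ, F × F')) ∞
      (fun x => TotalSpace.mk' (F × F') (E := V ×ᵇ W) x (s x, t x)) ↔
    ContMDiff 𝓘(ℝ, E) (𝓘(ℝ, E).prod 𝓘(ℝ, F)) ∞ (fun x => TotalSpace.mk' F x (s x)) ∧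
    ContMDiff 𝓘(ℝ, E) (𝓘(ℝ, E).prod 𝓘(ℝ, F')) ∞ (fun x => TotalSpace.mk' F' x (t x)) := by
  refine Iff.trans (forall_congr' fun x => ?_) forall_and
  rw [contMDiffAt_section, contMDiffAt_section, contMDiffAt_section]
  exact contMDiffAt_prod_module_iff _

/-- The section `X + α` of `V ⊕ W`. -/
def secMk (s : Sec E F V) (t : Sec E F' W) : Sec E (F × F') (V ×ᵇ W) :=
  ⟨fun x => (s x, t x), (contMDiff_sum_iff _ _).2 ⟨s.contMDiff, t.contMDiff⟩⟩

/-- The `V`-component of a section of `V ⊕ W`. -/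
def secFst (u : Sec E (F × F') (V ×ᵇ W)) : Sec E F V :=
  ⟨fun x => (u x).1, ((contMDiff_sum_iff _ _).1 u.contMDiff).1⟩

/-- The `W`-component of a section of `V ⊕ W`. -/
def secSnd (u : Sec E (F × F') (V ×ᵇ W)) : Sec E F' W :=
  ⟨fun x => (u x).2, ((contMDiff_sum_iff _ _).1 u.contMDiff).2⟩

variable [FiniteDimensional ℝ E] [T2Space M] [IsManifold 𝓘(ℝ, E) ∞ M]
  [FiniteDimensional ℝ F] [ContMDiffVectorBundle ∞ F V 𝓘(ℝ, E)]
  [FiniteDimensional ℝ F'] [ContMDiffVectorBundle ∞ F' W 𝓘(ℝ, E)]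

/-- The anchor `ρ₀ ⊕ ρ₁` on `V ⊕ W`. -/
def sumAnchor (ρ₀ : Anchor E F V) (ρ₁ : Anchor E F' W) : Anchor E (F × F') (V ×ᵇ W) :=
  ⟨fun x => (ρ₀ x).coprod (ρ₁ x), contMDiff_hom (V := V ×ᵇ W) (W := TB E M) _ fun u =>
    (happ ρ₀ (secFst u) + happ ρ₁ (secSnd u)).contMDiff⟩

end Sum

section Compatible

variable {E : Type*} [NormedAddCommGroup E] [NormedSpace ℝ E] [FiniteDimensional ℝ E]
  {M : Type*} [TopologicalSpace M] [ChartedSpace E M] [T2Space M] [IsManifold 𝓘(ℝ, E) ∞ M]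
  {F : Type*} [NormedAddCommGroup F] [NormedSpace ℝ F] [FiniteDimensional ℝ F]
  {V : M → Type*} [TopologicalSpace (TotalSpace F V)]
  [∀ x, AddCommGroup (V x)] [∀ x, Module ℝ (V x)] [∀ x, TopologicalSpace (V x)]
  [FiberBundle F V] [VectorBundle ℝ F V] [ContMDiffVectorBundle ∞ F V 𝓘(ℝ, E)]
  {ρ₀ : Anchor E F V} {ρ₁ : Anchor E (F →L[ℝ] ℝ) (DualB V)}

theorem happ_sumAnchor (u : Sec E (F × (F →L[ℝ] ℝ)) (V ×ᵇ DualB V)) :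
    happ (sumAnchor ρ₀ ρ₁) u = happ ρ₀ (secFst u) + happ ρ₁ (secSnd u) := rfl

/-- The extension of `S` and `T` to a right-anchored product on `V ⊕ V*`:
`∇_{X+α}(Y+β) = S_X Y + T*_α Y + S*_X β + T_α β`. -/
def extend (S : RAProduct ρ₀) (T : RAProduct ρ₁) : RAProduct (sumAnchor ρ₀ ρ₁) where
  conn u v := secMk
    (S.conn (secFst u) (secFst v) + T.predual.conn (secSnd u) (secFst v))
    (S.dual.conn (secFst u) (secSnd v) + T.conn (secSnd u) (secSnd v))
  add_left u u' v := by
    have h1 : secFst (u + u') = secFst u + secFst u' := rfl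
    have h2 : secSnd (u + u') = secSnd u + secSnd u' := rfl
    rw [h1, h2, S.add_left, S.dual.add_left, T.add_left, T.predual.add_left]
    refine ContMDiffSection.ext fun x => Prod.ext ?_ ?_
    · exact add_add_add_comm _ _ _ _
    · exact add_add_add_comm _ _ _ _
  add_right u v v' := by
    have h1 : secFst (v + v') = secFst v + secFst v' := rfl
    have h2 : secSnd (v + v') = secSnd v + secSnd v' := rfl
    rw [h1, h2, S.add_right, S.dual.add_right, T.add_right, T.predual.add_right]
    refine ContMDiffSection.ext fun x => Prod.ext ?_ ?_
    · exact add_add_add_comm _ _ _ _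
    · exact add_add_add_comm _ _ _ _
  fsmul_left f u v := by
    have h1 : secFst (f • u) = f • secFst u := rfl
    have h2 : secSnd (f • u) = f • secSnd u := rfl
    rw [h1, h2, S.fsmul_left, S.dual.fsmul_left, T.fsmul_left, T.predual.fsmul_left]
    refine ContMDiffSection.ext fun x => Prod.ext ?_ ?_
    · exact (smul_add _ _ _).symm
    · exact (smul_add _ _ _).symm
  leibniz f u v := by
    have h1 : secFst (f • v) = f • secFst v := rfl
    have h2 : secSnd (f • v) = f • secSnd v := rfl
    rw [h1, h2, S.leibniz, S.dual.leibniz, T.leibniz, T.predual.leibniz, happ_sumAnchor,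
      der_add_left]
    have h3 : ∀ {G : Type _} [AddCommGroup G] [Module ℝ G] (c p q : ℝ) (a b v : G),
        (c • a + p • v) + (c • b + q • v) = c • (a + b) + (p + q) • v := by
      intros; module
    refine ContMDiffSection.ext fun x => Prod.ext ?_ ?_
    · exact h3 _ _ _ _ _ _
    · exact h3 _ _ _ _ _ _

/-- Two left symmetric algebroids `(V, M, ρ₀, S)` and `(V*, M, ρ₁, T)` on dual vector bundles are
compatible: with `∇ = extend S T`, one has `R(X, α) Y = R(Y, α) X` and
`R(α, X) β = R(β, X) α`. -/
structure Compatible (S : RAProduct ρ₀) (T : RAProduct ρ₁) : Prop where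
  left : S.IsLeftSymmetric
  right : T.IsLeftSymmetric
  curv_left : ∀ (X Y : Sec E F V) (α : Sec E (F →L[ℝ] ℝ) (DualB V)),
    (extend S T).curv (secMk X 0) (secMk 0 α) (secMk Y 0) =
      (extend S T).curv (secMk Y 0) (secMk 0 α) (secMk X 0)
  curv_right : ∀ (α β : Sec E (F →L[ℝ] ℝ) (DualB V)) (X : Sec E F V),
    (extend S T).curv (secMk 0 α) (secMk X 0) (secMk 0 β) =
      (extend S T).curv (secMk 0 β) (secMk X 0) (secMk 0 α)

end Compatible

section LieAlgebroid

variable {E : Type*} [NormedAddCommGroup E] [NormedSpace ℝ E]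
  {M : Type*} [TopologicalSpace M] [ChartedSpace E M] [IsManifold 𝓘(ℝ, E) ∞ M]
  {F : Type*} [NormedAddCommGroup F] [NormedSpace ℝ F]
  {V : M → Type*} [TopologicalSpace (TotalSpace F V)]
  [∀ x, AddCommGroup (V x)] [∀ x, Module ℝ (V x)] [∀ x, TopologicalSpace (V x)]
  [∀ x, IsTopologicalAddGroup (V x)] [∀ x, ContinuousSMul ℝ (V x)]
  [FiberBundle F V] [VectorBundle ℝ F V]

/-- `(V, M, ρ, [ , ])` is a Lie algebroid. -/
structure IsLieAlgebroid (ρ : Anchor E F V) (br : Sec E F V → Sec E F V → Sec E F V) : Prop where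
  add_right : ∀ a b c, br a (b + c) = br a b + br a c
  skew : ∀ a b, br a b = -br b a
  anchored : ∀ (f : Fn E M) a b, br a (f • b) = f • br a b + der (happ ρ a) f • b
  jacobi : ∀ a b c, br (br a b) c + br (br b c) a + br (br c a) b = 0

/-- The bilinear form `B` on the real vector space `U` has signature `(p, q)`. -/
def HasSignature {U : Type*} [AddCommGroup U] [Module ℝ U] (B : U → U → ℝ) (p q : ℕ) : Prop :=
  ∃ e : Module.Basis (Fin p ⊕ Fin q) ℝ U,
    (∀ i j, i ≠ j → B (e i) (e j) = 0) ∧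
    (∀ i, B (e (Sum.inl i)) (e (Sum.inl i)) = 1) ∧
    ∀ j, B (e (Sum.inr j)) (e (Sum.inr j)) = -1

/-- `g` is a pseudo-Riemannian metric (of some signature `(p, q)`) on the vector bundle `V`. -/
structure IsPseudoRiemannian (g : Bil E F V) : Prop where
  symm : ∀ x (u v : V x), (g x u v : ℝ) = g x v u
  nondegenerate : ∀ x (u : V x), (∀ v : V x, (g x u v : ℝ) = 0) → u = 0
  signature : ∃ p q : ℕ, ∀ x, HasSignature (fun u v : V x => (g x u v : ℝ)) p q

/-- `D` is the Levi-Civita connection of `g` on the Lie algebroid `(V, M, ρ, [ , ])`. -/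
structure IsLeviCivita {ρ : Anchor E F V} (br : Sec E F V → Sec E F V → Sec E F V)
    (g : Bil E F V) (D : AConn ρ F V) : Prop where
  metric : ∀ a b c, der (happ ρ a) (bil g b c) = bil g (D.conn a b) c + bil g b (D.conn a c)
  torsionFree : ∀ a b, D.conn a b - D.conn b a = br a b

/-- `(V, M, ρ, [ , ], g, K)` is a para-Kähler Lie algebroid. The Levi-Civita connection is
characterised, hence uniquely determined, by `IsLeviCivita`. -/
structure IsParaKahler (ρ : Anchor E F V) (br : Sec E F V → Sec E F V → Sec E F V)
    (g : Bil E F V) (K : Sec E (F →L[ℝ] F) (HomB V V)) : Prop where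
  lieAlgebroid : IsLieAlgebroid ρ br
  pseudoRiemannian : IsPseudoRiemannian g
  involutive : ∀ x (u : V x), K x (K x u) = u
  skew : ∀ x (u v : V x), (g x (K x u) v : ℝ) = -(g x u (K x v) : ℝ)
  parallel : ∃ D : AConn ρ F V, IsLeviCivita br g D ∧
    ∀ a b, D.conn a (happ K b) = happ K (D.conn a b)

/-- `Ω` is a symplectic form on the Lie algebroid `(V, M, ρ, [ , ])`. -/
structure IsSymplectic (ρ : Anchor E F V) (br : Sec E F V → Sec E F V → Sec E F V)
    (Ω : Bil E F V) : Prop where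
  skew : ∀ x (u v : V x), (Ω x u v : ℝ) = -(Ω x v u : ℝ)
  nondegenerate : ∀ x (u : V x), (∀ v : V x, (Ω x u v : ℝ) = 0) → u = 0
  closed : ∀ a b c,
    der (happ ρ a) (bil Ω b c) + der (happ ρ b) (bil Ω c a) + der (happ ρ c) (bil Ω a b)
      - bil Ω (br a b) c - bil Ω (br b c) a - bil Ω (br c a) b = 0

end LieAlgebroid

section Fundamental

variable {E : Type*} [NormedAddCommGroup E] [NormedSpace ℝ E] [FiniteDimensional ℝ E]
  {M : Type*} [TopologicalSpace M] [ChartedSpace E M] [T2Space M] [IsManifold 𝓘(ℝ, E) ∞ M]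
  {F : Type*} [NormedAddCommGroup F] [NormedSpace ℝ F] [FiniteDimensional ℝ F]
  {V : M → Type*} [TopologicalSpace (TotalSpace F V)]
  [∀ x, AddCommGroup (V x)] [∀ x, Module ℝ (V x)] [∀ x, TopologicalSpace (V x)]
  [∀ x, IsTopologicalAddGroup (V x)] [∀ x, ContinuousSMul ℝ (V x)]
  [FiberBundle F V] [VectorBundle ℝ F V] [ContMDiffVectorBundle ∞ F V 𝓘(ℝ, E)]

/-- The form `Ω_K(a, b) = ⟨K a, b⟩`. -/
def fundForm (g : Bil E F V) (K : Sec E (F →L[ℝ] F) (HomB V V)) : Bil E F V :=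
  ⟨fun x => (g x).comp (K x), contMDiff_hom (V := V) (W := DualB V) _ fun s =>
    (happ g (happ K s)).contMDiff⟩

/-- A fibrewise bilinear form which is smooth on smooth sections. -/
theorem exists_bil (B : ∀ x, V x →ₗ[ℝ] V x →ₗ[ℝ] ℝ)
    (hB : ∀ a b : Sec E F V, ContMDiff 𝓘(ℝ, E) 𝓘(ℝ, ℝ) ∞ (fun x => B x (a x) (b x))) :
    ∃ g : Bil E F V, ∀ x u v, (g x u v : ℝ) = B x u v := by
  have hp : ∀ x, ∃ φ : HomB V (DualB V) x, ∀ u v, (φ u v : ℝ) = B x u v := by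
    intro x
    have : T2Space (V x) := FiberBundle.t2Space F V x
    have : FiniteDimensional ℝ (V x) := VectorBundle.finiteDimensional ℝ F V x
    refine ⟨LinearMap.toContinuousLinearMap
      ((LinearMap.toContinuousLinearMap (E := V x) (F' := ℝ)).toLinearMap.comp (B x)),
      fun u v => rfl⟩
  choose φ hφ using hp
  refine ⟨⟨φ, contMDiff_hom (V := V) (W := DualB V) φ fun a =>
    contMDiff_dual (fun x => φ x (a x)) fun b => ?_⟩, hφ⟩
  simp only [hφ]
  exact hB a b

end Fundamental

section Affine

variable {E : Type*} [NormedAddCommGroup E] [NormedSpace ℝ E] [FiniteDimensional ℝ E]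
  {M : Type*} [TopologicalSpace M] [ChartedSpace E M] [T2Space M] [IsManifold 𝓘(ℝ, E) ∞ M]

/-- Smooth `1`-forms on `M`. -/
abbrev Form (E M : Type*) [NormedAddCommGroup E] [NormedSpace ℝ E] [TopologicalSpace M]
    [ChartedSpace E M] [IsManifold 𝓘(ℝ, E) ∞ M] := Sec E (E →L[ℝ] ℝ) (DualB (TB E M))

variable (E M) in
/-- The identity anchor of `TM`. -/
def idAnchor : Anchor E E (TB E M) :=
  ⟨fun x => ContinuousLinearMap.id ℝ (TB E M x), contMDiff_hom (V := TB E M) (W := TB E M) _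
    fun X => X.contMDiff⟩

/-- The linear connection `D` on `TM` is torsion-free and flat. -/
structure IsAffine (D : RAProduct (idAnchor E M)) : Prop where
  torsionFree : ∀ X Y, D.conn X Y - D.conn Y X = lie X Y
  flat : ∀ X Y Z,
    D.conn X (D.conn Y Z) - D.conn Y (D.conn X Z) - D.conn (lie X Y) Z = 0

/-- `∇_X h (α, β) = X.h(α, β) - h(∇*_X α, β) - h(α, ∇*_X β)` for a field `h` of bilinear forms
on `T*M`. -/
def covBiv (D : RAProduct (idAnchor E M)) (X : Sec E E (TB E M))
    (h : Bil E (E →L[ℝ] ℝ) (DualB (TB E M))) (α β : Form E M) : Fn E M :=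
  der X (bil h α β) - bil h (D.dual.conn X α) β - bil h α (D.dual.conn X β)

theorem happ_idAnchor (X : Sec E E (TB E M)) : happ (idAnchor E M) X = X := rfl

section Bivector

variable (D : RAProduct (idAnchor E M)) (h : Bil E (E →L[ℝ] ℝ) (DualB (TB E M)))

theorem bil_add_left (a b c : Form E M) : bil h (a + b) c = bil h a c + bil h b c := by
  rw [bil, happ_add, add_pair]; rfl

theorem bil_fsmul_left (f : Fn E M) (a c : Form E M) : bil h (f • a) c = f * bil h a c := by
  rw [bil, happ_fsmul, fsmul_pair]; rfl

theorem bil_add_right (a b c : Form E M) : bil h a (b + c) = bil h a b + bil h a c :=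
  pair_add _ _ _

theorem bil_fsmul_right (f : Fn E M) (a c : Form E M) : bil h a (f • c) = f * bil h a c :=
  pair_fsmul _ _ _

theorem exists_calD (α β : Form E M) : ∃ γ : Form E M, ∀ X,
    pair γ X = covBiv D X h α β + pair (D.dual.conn (happ (sharp h) α) β) X :=
  exists_form
    { toFun := fun X => covBiv D X h α β + pair (D.dual.conn (happ (sharp h) α) β) X
      map_add' := fun X Y => by
        simp only [covBiv, D.dual.add_left, der_add_left, bil_add_left, bil_add_right, pair_add]
        ring
      map_smul' := fun f X => by
        simp only [covBiv, D.dual.fsmul_left, der_fsmul_left, bil_fsmul_left, bil_fsmul_right,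
          pair_fsmul, RingHom.id_apply, smul_eq_mul]
        ring }

/-- The right-anchored product `𝒟` on `(T*M, h_#)` attached to `h`:
`⟨𝒟_α β, X⟩ = ∇_X h (α, β) + ⟨∇*_{h_# α} β, X⟩`. -/
def calD : RAProduct (sharp h) where
  conn α β := (exists_calD D h α β).choose
  add_left α β γ := form_ext fun X => by
    rw [add_pair, (exists_calD D h _ _).choose_spec, (exists_calD D h _ _).choose_spec,
      (exists_calD D h _ _).choose_spec]
    simp only [covBiv, D.dual.add_left, D.dual.add_right, happ_add, der_add, bil_add_left,
      add_pair]
    ring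
  add_right α β γ := form_ext fun X => by
    rw [add_pair, (exists_calD D h _ _).choose_spec, (exists_calD D h _ _).choose_spec,
      (exists_calD D h _ _).choose_spec]
    simp only [covBiv, D.dual.add_right, der_add, bil_add_right, add_pair]
    ring
  fsmul_left f α β := form_ext fun X => by
    rw [fsmul_pair, (exists_calD D h _ _).choose_spec, (exists_calD D h _ _).choose_spec]
    simp only [covBiv, D.dual.leibniz, D.dual.fsmul_left, happ_fsmul, der_mul, bil_add_left,
      bil_fsmul_left, fsmul_pair, happ_idAnchor]
    ring
  leibniz f α β := form_ext fun X => by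
    rw [add_pair, fsmul_pair, fsmul_pair, (exists_calD D h _ _).choose_spec,
      (exists_calD D h _ _).choose_spec]
    simp only [covBiv, D.dual.leibniz, der_mul, bil_add_right,
      bil_fsmul_right, add_pair, fsmul_pair, happ_idAnchor]
    ring

theorem pair_calD (α β : Form E M) (X : Sec E E (TB E M)) :
    pair ((calD D h).conn α β) X =
      covBiv D X h α β + pair (D.dual.conn (happ (sharp h) α) β) X :=
  (exists_calD D h α β).choose_spec X

/-- The bundle `TM ⊕ T*M`. -/
abbrev PhiTM (E M : Type*) [NormedAddCommGroup E] [NormedSpace ℝ E] [TopologicalSpace M]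
    [ChartedSpace E M] : M → Type _ := TB E M ×ᵇ DualB (TB E M)

/-- The anchor `Id + 0` of `TM ⊕ T*M`. -/
def phiAnchor : Anchor E (E × (E →L[ℝ] ℝ)) (PhiTM E M) := sumAnchor (idAnchor E M) 0

/-- The bracket `[X+α, Y+β]^▷ = [X, Y] + ∇*_X β - ∇*_Y α`. -/
def phiBracket (u v : Sec E (E × (E →L[ℝ] ℝ)) (PhiTM E M)) :
    Sec E (E × (E →L[ℝ] ℝ)) (PhiTM E M) :=
  secMk (lie (secFst u) (secFst v))
    (D.dual.conn (secFst u) (secSnd v) - D.dual.conn (secFst v) (secSnd u))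

theorem exists_phiMetric : ∃ g : Bil E (E × (E →L[ℝ] ℝ)) (PhiTM E M),
    ∀ x (u v : PhiTM E M x),
      (g x u v : ℝ) = (u.2 v.1 : ℝ) + (v.2 u.1 : ℝ) - 2 * (h x u.2 v.2 : ℝ) :=
  exists_bil (V := PhiTM E M)
    (fun x => LinearMap.mk₂ ℝ (fun u v : PhiTM E M x =>
      (u.2 v.1 : ℝ) + (v.2 u.1 : ℝ) - 2 * (h x u.2 v.2 : ℝ))
      (fun u u' v => by
        have h1 := map_add (h x) u.2 u'.2
        have h2 := map_add v.2 u.1 u'.1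
        simp only [Prod.fst_add, Prod.snd_add, h1, h2, add_apply]
        ring)
      (fun c u v => by
        simp
        ring)
      (fun u v v' => by
        simp
        ring)
      (fun c u v => by
        simp
        ring))
    fun a b => (pair (secSnd a) (secFst b) + pair (secSnd b) (secFst a) -
      (ContMDiffMap.const 2 : Fn E M) * bil h (secSnd a) (secSnd b)).contMDiff

/-- The metric `⟨X+α, Y+β⟩_h = ⟨α, Y⟩ + ⟨β, X⟩ - 2 h(α, β)`. -/
def phiMetric : Bil E (E × (E →L[ℝ] ℝ)) (PhiTM E M) := (exists_phiMetric h).choose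

theorem phiMetric_apply (x : M) (u v : PhiTM E M x) :
    (phiMetric h x u v : ℝ) = (u.2 v.1 : ℝ) + (v.2 u.1 : ℝ) - 2 * (h x u.2 v.2 : ℝ) :=
  (exists_phiMetric h).choose_spec x u v

/-- The endomorphism `K_h(X+α) = X - 2 h_# α - α`. -/
def phiK : Sec E (E × (E →L[ℝ] ℝ) →L[ℝ] E × (E →L[ℝ] ℝ)) (HomB (PhiTM E M) (PhiTM E M)) :=
  ⟨fun x => (ContinuousLinearMap.fst ℝ (TB E M x) (DualB (TB E M) x) -
      (2 : ℝ) • (sharp h x).comp (ContinuousLinearMap.snd ℝ (TB E M x) (DualB (TB E M) x))).prod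
      (-ContinuousLinearMap.snd ℝ (TB E M x) (DualB (TB E M) x)),
    contMDiff_hom (V := PhiTM E M) (W := PhiTM E M) _ fun u =>
      (secMk (secFst u - (ContMDiffMap.const 2 : Fn E M) • happ (sharp h) (secSnd u)) (-secSnd u)).contMDiff⟩

theorem phiK_apply (x : M) (u : PhiTM E M x) :
    phiK h x u = (u.1 - (2 : ℝ) • sharp h x u.2, -u.2) := rfl

end Bivector

end Affine

end Algebroid

end

open Algebroid

/-! Everything reduces to one identity. Since `∇_X h(α, β) = ⟨β, ∇_X(h_# α) - h_#(∇*_X α)⟩`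
(`covBiv_eq_pair`) and `∇` is torsion-free, the Codazzi difference at `(α, β, γ)` is `γ` evaluated
on `Z = [h_# α, h_# β] - h_#(∇*_{h_# α} β - ∇*_{h_# β} α)` (`IsAffine.pair_lie_sub_sharp`). By
symmetry of `h` the parenthesis is the bracket of `𝒟` (`calD_bracket`), so the Codazzi equation says
exactly that the anchor `h_#` preserves brackets.

If `𝒟` is left symmetric, its anchor preserves brackets: the Leibniz rule in `R(α, β)(fγ) = 0`
leaves `Z(f) γ = 0`, and differentials of functions separate tangent vectors. Conversely, expand
`𝒟_α 𝒟_β γ` with the second derivatives of `h` interchanged (`IsAffine.pair_calD_calD`). Then `R^𝒟`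
is a sum of Codazzi differences, their derivatives, and the curvature of `∇*` along `h_# α`, `h_#
β`; all of these vanish.

The compatibility identities put no further condition on `h`. Both mixed curvatures equal `-∇²_{X,Y}
h(α, β)`, which is symmetric in `X, Y` because `∇` is flat and torsion-free, and in `α, β` because
`h` is symmetric.

For the para-Kähler structure, the extension of `(∇, 𝒟)` to `TM ⊕ T*M` preserves the canonical
pairing and both summands, hence `K_0 = Id ⊕ (-Id)`. The shear `X + α ↦ X + h_# α + α` carries the
pairing to `⟨ , ⟩_h`, `K_0` to `K_h` and the anchor `Id + h_#` to `Id + 0`. Under the Codazzi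
equation it also carries the bracket of the extension to `[ , ]^▷`, so the sheared extension is the
Levi-Civita connection and leaves `K_h` parallel. -/

namespace Algebroid

/-! ### Additive rules for pairings, derivations and connections -/

section Algebra

variable {E : Type*} [NormedAddCommGroup E] [NormedSpace ℝ E]
  {M : Type*} [TopologicalSpace M] [ChartedSpace E M]
  {F : Type*} [NormedAddCommGroup F] [NormedSpace ℝ F]
  {V : M → Type*} [TopologicalSpace (TotalSpace F V)]
  [∀ x, AddCommGroup (V x)] [∀ x, Module ℝ (V x)] [∀ x, TopologicalSpace (V x)]
  [FiberBundle F V] [VectorBundle ℝ F V]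
  {F' : Type*} [NormedAddCommGroup F'] [NormedSpace ℝ F']
  {W : M → Type*} [TopologicalSpace (TotalSpace F' W)]
  [∀ x, AddCommGroup (W x)] [∀ x, Module ℝ (W x)] [∀ x, TopologicalSpace (W x)]
  [FiberBundle F' W] [VectorBundle ℝ F' W]

theorem pair_neg (α : Sec E (F →L[ℝ] ℝ) (DualB V)) (s : Sec E F V) :
    pair α (-s) = -pair α s := by
  ext x; exact map_neg (α x) (s x)

theorem pair_sub (α : Sec E (F →L[ℝ] ℝ) (DualB V)) (s t : Sec E F V) :
    pair α (s - t) = pair α s - pair α t := by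
  ext x; exact map_sub (α x) (s x) (t x)

theorem pair_zero (α : Sec E (F →L[ℝ] ℝ) (DualB V)) : pair α (0 : Sec E F V) = 0 := by
  ext x; exact map_zero (α x)

theorem neg_pair (α : Sec E (F →L[ℝ] ℝ) (DualB V)) (s : Sec E F V) :
    pair (-α) s = -pair α s := rfl

theorem sub_pair (α β : Sec E (F →L[ℝ] ℝ) (DualB V)) (s : Sec E F V) :
    pair (α - β) s = pair α s - pair β s := by
  rw [sub_eq_add_neg, add_pair, neg_pair, ← sub_eq_add_neg]

theorem zero_pair (s : Sec E F V) : pair (0 : Sec E (F →L[ℝ] ℝ) (DualB V)) s = 0 := rfl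

section

variable [∀ x, IsTopologicalAddGroup (W x)] [∀ x, ContinuousSMul ℝ (W x)]

theorem happ_neg (φ : Sec E (F →L[ℝ] F') (HomB V W)) (s : Sec E F V) :
    happ φ (-s) = -happ φ s := by
  ext x; exact map_neg (φ x) (s x)

theorem happ_sub (φ : Sec E (F →L[ℝ] F') (HomB V W)) (s t : Sec E F V) :
    happ φ (s - t) = happ φ s - happ φ t := by
  ext x; exact map_sub (φ x) (s x) (t x)

end

variable [IsManifold 𝓘(ℝ, E) ∞ M]

theorem der_zero (X : Sec E E (TB E M)) : der X (0 : Fn E M) = 0 := by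
  have h1 := der_add X 0 0
  rw [add_zero] at h1
  exact left_eq_add.1 h1

theorem der_neg (X : Sec E E (TB E M)) (f : Fn E M) : der X (-f) = -der X f := by
  have h1 := der_add X (-f) f
  rw [neg_add_cancel, der_zero] at h1
  exact eq_neg_of_add_eq_zero_left h1.symm

theorem der_sub (X : Sec E E (TB E M)) (f g : Fn E M) : der X (f - g) = der X f - der X g := by
  rw [sub_eq_add_neg, der_add, der_neg, ← sub_eq_add_neg]

theorem der_sub_left (X Y : Sec E E (TB E M)) (f : Fn E M) :
    der (X - Y) f = der X f - der Y f := by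
  ext x; exact map_sub (mvfderiv 𝓘(ℝ, E) f x) (X x) (Y x)

variable {ρ : Anchor E F V} (T : AConn ρ F' W)

namespace AConn

theorem zero_left (s : Sec E F' W) : T.conn 0 s = 0 := by
  have h1 := T.add_left 0 0 s
  rw [add_zero] at h1
  exact left_eq_add.1 h1

theorem zero_right (a : Sec E F V) : T.conn a 0 = 0 := by
  have h1 := T.add_right a 0 0
  rw [add_zero] at h1
  exact left_eq_add.1 h1

theorem neg_left (a : Sec E F V) (s : Sec E F' W) : T.conn (-a) s = -T.conn a s := by
  have h1 := T.add_left (-a) a s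
  rw [neg_add_cancel, T.zero_left] at h1
  exact eq_neg_of_add_eq_zero_left h1.symm

theorem neg_right (a : Sec E F V) (s : Sec E F' W) : T.conn a (-s) = -T.conn a s := by
  have h1 := T.add_right a (-s) s
  rw [neg_add_cancel, T.zero_right] at h1
  exact eq_neg_of_add_eq_zero_left h1.symm

theorem sub_left (a b : Sec E F V) (s : Sec E F' W) :
    T.conn (a - b) s = T.conn a s - T.conn b s := by
  rw [sub_eq_add_neg, T.add_left, T.neg_left, ← sub_eq_add_neg]

theorem sub_right (a : Sec E F V) (s t : Sec E F' W) :
    T.conn a (s - t) = T.conn a s - T.conn a t := by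
  rw [sub_eq_add_neg, T.add_right, T.neg_right, ← sub_eq_add_neg]

end AConn

end Algebra

/-! ### Differentials of global functions separate tangent vectors -/

section Separation

variable {E : Type*} [NormedAddCommGroup E] [NormedSpace ℝ E] [FiniteDimensional ℝ E]
  {M : Type*} [TopologicalSpace M] [ChartedSpace E M] [T2Space M] [IsManifold 𝓘(ℝ, E) ∞ M]

/-- Every covector at a point is the differential of a smooth function. -/
theorem exists_mvfderiv_eq (x : M) (l : TB E M x →L[ℝ] ℝ) :
    ∃ f : Fn E M, ∀ v : TB E M x, mvfderiv 𝓘(ℝ, E) f x v = l v := by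
  obtain ⟨χ, h1, h2⟩ := exists_bump E x (extChartAt_source_mem_nhds (I := 𝓘(ℝ, E)) x)
  let A : TB E M x →L[ℝ] E := mfderiv 𝓘(ℝ, E) 𝓘(ℝ, E) (extChartAt 𝓘(ℝ, E) x) x
  have hA : A.IsInvertible := isInvertible_mfderiv_extChartAt (mem_extChartAt_source x)
  -- Precomposing with the inverse of the differential of the chart makes `l' ∘ chart` have
  -- differential `l` at `x`.
  let l' : E →L[ℝ] ℝ := l.comp A.inverse
  let c : M → ℝ := fun y => l' (extChartAt 𝓘(ℝ, E) x y)
  have hc : ContMDiffOn 𝓘(ℝ, E) 𝓘(ℝ, ℝ) ∞ c (extChartAt 𝓘(ℝ, E) x).source := by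
    rw [extChartAt_source]
    exact l'.contMDiff.comp_contMDiffOn (contMDiffOn_extChartAt (I := 𝓘(ℝ, E)) (n := ∞) (x := x))
  have hf : ContMDiff 𝓘(ℝ, E) 𝓘(ℝ, ℝ) ∞ (fun y => χ y * c y) := by
    refine contMDiff_of_tsupport fun y hy => ?_
    have hy' := h1 (tsupport_smul_subset_left (f := χ) (g := c) hy)
    exact χ.contMDiff.contMDiffAt.mul
      (hc.contMDiffAt ((isOpen_extChartAt_source (I := 𝓘(ℝ, E)) x).mem_nhds hy'))
  refine ⟨⟨_, hf⟩, fun v => ?_⟩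
  -- The cut-off is `1` near `x`, so it does not change the differential there.
  have h3 : (fun y => χ y * c y) =ᶠ[nhds x] c := by
    filter_upwards [h2] with y hy
    rw [hy, one_mul]
  have h4 : HasMFDerivAt 𝓘(ℝ, E) 𝓘(ℝ, E) (extChartAt 𝓘(ℝ, E) x) x A :=
    (mdifferentiableAt_extChartAt (mem_chart_source E x)).hasMFDerivAt
  have h5 : HasMFDerivAt 𝓘(ℝ, E) 𝓘(ℝ, ℝ) c x (l'.comp A) :=
    l'.hasMFDerivAt.comp x h4
  have h6 : mfderiv 𝓘(ℝ, E) 𝓘(ℝ, ℝ) (fun y => χ y * c y) x = l'.comp A :=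
    (h5.congr_of_eventuallyEq h3).mfderiv
  refine (congrArg (fun m : TB E M x →L[ℝ] ℝ => m v) h6).trans ?_
  exact congrArg l (hA.inverse_apply_self v)

theorem eq_zero_of_der_eq_zero (Z : Sec E E (TB E M)) (x : M) (h : ∀ f : Fn E M, der Z f x = 0) :
    Z x = 0 := by
  have : FiniteDimensional ℝ (TB E M x) := ‹FiniteDimensional ℝ E›
  have : T2Space (TB E M x) := FiberBundle.t2Space E (TB E M) x
  rw [← Module.forall_dual_apply_eq_zero_iff ℝ]
  intro l
  obtain ⟨f, hf⟩ := exists_mvfderiv_eq x (LinearMap.toContinuousLinearMap l)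
  exact (hf (Z x)).symm.trans (h f)

end Separation

/-! ### Calculus of a flat torsion-free connection and of `∇h` -/

section AffineCalculus

variable {E : Type*} [NormedAddCommGroup E] [NormedSpace ℝ E] [FiniteDimensional ℝ E]
  {M : Type*} [TopologicalSpace M] [ChartedSpace E M] [T2Space M] [IsManifold 𝓘(ℝ, E) ∞ M]
  {D : RAProduct (idAnchor E M)}

theorem pair_dual_idAnchor (D : RAProduct (idAnchor E M)) (X Y : Sec E E (TB E M)) (α : Form E M) :
    pair (D.dual.conn X α) Y = der X (pair α Y) - pair α (D.conn X Y) :=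
  D.pair_dual X α Y

theorem lie_swap (X Y : Sec E E (TB E M)) : lie X Y = -lie Y X := by
  ext x
  exact congrFun (VectorField.mlieBracket_swap (I := 𝓘(ℝ, E)) (V := X) (W := Y)) x

theorem IsAffine.conn_sub_conn (hD : IsAffine D) (X Y Z : Sec E E (TB E M)) :
    D.conn X (D.conn Y Z) - D.conn Y (D.conn X Z) = D.conn (lie X Y) Z :=
  sub_eq_zero.1 (hD.flat X Y Z)

/-- The Lie bracket of vector fields acts on functions as the commutator. -/
theorem IsAffine.der_lie (hD : IsAffine D) (X Y : Sec E E (TB E M)) (f : Fn E M) :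
    der (lie X Y) f = der X (der Y f) - der Y (der X f) := by
  -- Flatness at `f • Z` minus `f` times flatness at `Z`: the mixed first-order terms cancel and
  -- only the action on `f`, multiplied by `Z`, survives.
  have h1 : ∀ Z : Sec E E (TB E M),
      (der X (der Y f) - der Y (der X f) - der (lie X Y) f) • Z = 0 := by
    intro Z
    have h2 := hD.flat X Y (f • Z)
    have h3 := hD.flat X Y Z
    simp only [D.leibniz, D.add_right, happ_idAnchor] at h2
    rw [← h2, ← sub_zero ((f • D.conn X (D.conn Y Z) + _ + _ - _ - _)), ← smul_zero f, ← h3]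
    module
  ext x
  by_cases hx : ∃ v : TB E M x, v ≠ 0
  · obtain ⟨v, hv⟩ := hx
    obtain ⟨Z, rfl⟩ := exists_sec E E x v
    have h4 := congrArg (fun W : Sec E E (TB E M) => W x) (h1 Z)
    have h5 := (smul_eq_zero.1 h4).resolve_right hv
    exact (sub_eq_zero.1 h5).symm
  -- Where the tangent space is trivial no `Z` can be divided out, but every derivative vanishes.
  · push Not at hx
    have h6 : ∀ (W : Sec E E (TB E M)) (g : Fn E M), der W g x = 0 := fun W g =>
      (congrArg (mvfderiv 𝓘(ℝ, E) g x) (hx (W x))).trans (map_zero _)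
    refine (h6 _ _).trans (Eq.symm ?_)
    show der X (der Y f) x - der Y (der X f) x = 0
    rw [h6, h6, sub_zero]

/-- The dual of a flat connection is flat. -/
theorem IsAffine.dual_conn_sub_conn (hD : IsAffine D) (X Y : Sec E E (TB E M)) (α : Form E M) :
    D.dual.conn X (D.dual.conn Y α) - D.dual.conn Y (D.dual.conn X α) =
      D.dual.conn (lie X Y) α := form_ext fun Z => by
  have h1 := congrArg (pair α) (hD.conn_sub_conn X Y Z)
  rw [pair_sub] at h1
  simp only [sub_pair, pair_dual_idAnchor, der_sub, hD.der_lie]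
  linear_combination -h1

theorem IsAffine.isLeftSymmetric (hD : IsAffine D) : D.IsLeftSymmetric := fun X Y Z => by
  rw [RAProduct.curv, RAProduct.bracket, hD.torsionFree]
  exact hD.flat X Y Z

/-- This is the first Bianchi identity read backwards: for a torsion-free connection the cyclic sum
of the curvature is the Jacobiator, and here the curvature is zero. -/
theorem IsAffine.lie_jacobi (hD : IsAffine D) (X Y Z : Sec E E (TB E M)) :
    lie (lie X Y) Z + lie (lie Y Z) X + lie (lie Z X) Y = 0 := by
  rw [← hD.torsionFree (lie X Y), ← hD.torsionFree (lie Y Z), ← hD.torsionFree (lie Z X),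
    ← hD.conn_sub_conn, ← hD.conn_sub_conn, ← hD.conn_sub_conn, ← hD.torsionFree,
    ← hD.torsionFree, ← hD.torsionFree]
  simp only [D.sub_right]
  abel

variable {h : Bil E (E →L[ℝ] ℝ) (DualB (TB E M))}

theorem bil_comm (hsymm : ∀ x (α β : DualB (TB E M) x), (h x α β : ℝ) = h x β α)
    (α β : Form E M) : bil h α β = bil h β α := by
  ext x; exact hsymm x (α x) (β x)

theorem covBiv_comm (D : RAProduct (idAnchor E M))
    (hsymm : ∀ x (α β : DualB (TB E M) x), (h x α β : ℝ) = h x β α)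
    (X : Sec E E (TB E M)) (α β : Form E M) : covBiv D X h α β = covBiv D X h β α := by
  simp only [covBiv, bil_comm hsymm _ β, bil_comm hsymm α (D.dual.conn X β)]
  ring

/-- `∇_X h (α, β) = ⟨β, ∇_X (h_# α) - h_# (∇*_X α)⟩`. -/
theorem covBiv_eq_pair (D : RAProduct (idAnchor E M)) (h : Bil E (E →L[ℝ] ℝ) (DualB (TB E M)))
    (X : Sec E E (TB E M)) (α β : Form E M) :
    covBiv D X h α β =
      pair β (D.conn X (happ (sharp h) α)) - pair β (happ (sharp h) (D.dual.conn X α)) := by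
  have h1 := pair_dual_idAnchor D X (happ (sharp h) α) β
  rw [pair_sharp, pair_sharp] at h1
  rw [covBiv, pair_sharp]
  linear_combination -h1

theorem covBiv_add_left (X Y : Sec E E (TB E M)) (α β : Form E M) :
    covBiv D (X + Y) h α β = covBiv D X h α β + covBiv D Y h α β := by
  simp only [covBiv, D.dual.add_left, der_add_left, bil_add_left, bil_add_right]
  ring

theorem bil_sub_left (α β γ : Form E M) : bil h (α - β) γ = bil h α γ - bil h β γ := by
  rw [eq_sub_iff_add_eq, ← bil_add_left, sub_add_cancel]

theorem bil_sub_right (α β γ : Form E M) : bil h α (β - γ) = bil h α β - bil h α γ :=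
  pair_sub _ _ _

theorem covBiv_sub_fst (X : Sec E E (TB E M)) (α β γ : Form E M) :
    covBiv D X h (α - β) γ = covBiv D X h α γ - covBiv D X h β γ := by
  simp only [covBiv, D.dual.sub_right, der_sub, bil_sub_left]
  ring

/-- The second covariant derivative `∇²_{X,Y} h (α, β)`. -/
noncomputable def covBiv₂ (D : RAProduct (idAnchor E M)) (X Y : Sec E E (TB E M))
    (h : Bil E (E →L[ℝ] ℝ) (DualB (TB E M))) (α β : Form E M) : Fn E M :=
  der X (covBiv D Y h α β) - covBiv D (D.conn X Y) h α β - covBiv D Y h (D.dual.conn X α) β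
    - covBiv D Y h α (D.dual.conn X β)

theorem covBiv₂_comm_forms (D : RAProduct (idAnchor E M))
    (hsymm : ∀ x (α β : DualB (TB E M) x), (h x α β : ℝ) = h x β α)
    (X Y : Sec E E (TB E M)) (α β : Form E M) : covBiv₂ D X Y h α β = covBiv₂ D X Y h β α := by
  simp only [covBiv₂, covBiv_comm D hsymm _ _ α, covBiv_comm D hsymm _ _ (D.dual.conn X α)]
  ring

/-- Ricci identity. Torsion-freeness turns the difference of the correction terms into `∇_{[X,Y]}
h`; what remains is the curvature of `∇*` acting on the two arguments, which is zero. -/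
theorem IsAffine.covBiv₂_comm (hD : IsAffine D) (X Y : Sec E E (TB E M)) (α β : Form E M) :
    covBiv₂ D X Y h α β = covBiv₂ D Y X h α β := by
  have h1 : covBiv D (D.conn X Y) h α β = covBiv D (D.conn Y X) h α β +
      covBiv D (lie X Y) h α β := by
    rw [← covBiv_add_left, ← hD.torsionFree, add_sub_cancel]
  rw [covBiv₂, covBiv₂, h1]
  simp only [covBiv, der_sub, hD.der_lie, ← hD.dual_conn_sub_conn, bil_sub_left, bil_sub_right]
  ring

end AffineCalculus

/-! ### Components of sections of a direct sum -/

section Extension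

variable {E : Type*} [NormedAddCommGroup E] [NormedSpace ℝ E]
  {M : Type*} [TopologicalSpace M] [ChartedSpace E M]
  {F : Type*} [NormedAddCommGroup F] [NormedSpace ℝ F]
  {V : M → Type*} [TopologicalSpace (TotalSpace F V)]
  [∀ x, AddCommGroup (V x)] [∀ x, Module ℝ (V x)] [∀ x, TopologicalSpace (V x)]
  [FiberBundle F V] [VectorBundle ℝ F V]
  {F' : Type*} [NormedAddCommGroup F'] [NormedSpace ℝ F']
  {W : M → Type*} [TopologicalSpace (TotalSpace F' W)]
  [∀ x, AddCommGroup (W x)] [∀ x, Module ℝ (W x)] [∀ x, TopologicalSpace (W x)]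
  [FiberBundle F' W] [VectorBundle ℝ F' W]

@[simp] theorem secFst_secMk (s : Sec E F V) (t : Sec E F' W) : secFst (secMk s t) = s := rfl

@[simp] theorem secSnd_secMk (s : Sec E F V) (t : Sec E F' W) : secSnd (secMk s t) = t := rfl

theorem sec_prod_ext {u v : Sec E (F × F') (V ×ᵇ W)} (h₁ : secFst u = secFst v)
    (h₂ : secSnd u = secSnd v) : u = v :=
  ContMDiffSection.ext fun x => Prod.ext (congrArg (fun s : Sec E F V => s x) h₁)
    (congrArg (fun s : Sec E F' W => s x) h₂)

theorem secFst_add (u v : Sec E (F × F') (V ×ᵇ W)) : secFst (u + v) = secFst u + secFst v := rfl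

theorem secSnd_add (u v : Sec E (F × F') (V ×ᵇ W)) : secSnd (u + v) = secSnd u + secSnd v := rfl

theorem secFst_sub (u v : Sec E (F × F') (V ×ᵇ W)) : secFst (u - v) = secFst u - secFst v := by
  rw [eq_sub_iff_add_eq, ← secFst_add, sub_add_cancel]

theorem secSnd_sub (u v : Sec E (F × F') (V ×ᵇ W)) : secSnd (u - v) = secSnd u - secSnd v := by
  rw [eq_sub_iff_add_eq, ← secSnd_add, sub_add_cancel]

theorem secFst_neg (u : Sec E (F × F') (V ×ᵇ W)) : secFst (-u) = -secFst u := by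
  rw [eq_neg_iff_add_eq_zero, ← secFst_add, neg_add_cancel]; rfl

theorem secSnd_neg (u : Sec E (F × F') (V ×ᵇ W)) : secSnd (-u) = -secSnd u := by
  rw [eq_neg_iff_add_eq_zero, ← secSnd_add, neg_add_cancel]; rfl

theorem secSnd_zero : secSnd (0 : Sec E (F × F') (V ×ᵇ W)) = 0 := rfl

theorem secFst_fsmul (f : Fn E M) (u : Sec E (F × F') (V ×ᵇ W)) :
    secFst (f • u) = f • secFst u := rfl

theorem secSnd_fsmul (f : Fn E M) (u : Sec E (F × F') (V ×ᵇ W)) :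
    secSnd (f • u) = f • secSnd u := rfl

end Extension

/-! ### Mixed curvatures of the extended product -/

section Extension

variable {E : Type*} [NormedAddCommGroup E] [NormedSpace ℝ E] [FiniteDimensional ℝ E]
  {M : Type*} [TopologicalSpace M] [ChartedSpace E M] [T2Space M] [IsManifold 𝓘(ℝ, E) ∞ M]
  {F : Type*} [NormedAddCommGroup F] [NormedSpace ℝ F] [FiniteDimensional ℝ F]
  {V : M → Type*} [TopologicalSpace (TotalSpace F V)]
  [∀ x, AddCommGroup (V x)] [∀ x, Module ℝ (V x)] [∀ x, TopologicalSpace (V x)]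
  [FiberBundle F V] [VectorBundle ℝ F V] [ContMDiffVectorBundle ∞ F V 𝓘(ℝ, E)]
  {ρ₀ : Anchor E F V} {ρ₁ : Anchor E (F →L[ℝ] ℝ) (DualB V)}
  (S : RAProduct ρ₀) (T : RAProduct ρ₁)

theorem secFst_extend (u v : Sec E (F × (F →L[ℝ] ℝ)) (V ×ᵇ DualB V)) :
    secFst ((extend S T).conn u v) =
      S.conn (secFst u) (secFst v) + T.predual.conn (secSnd u) (secFst v) := rfl

theorem secSnd_extend (u v : Sec E (F × (F →L[ℝ] ℝ)) (V ×ᵇ DualB V)) :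
    secSnd ((extend S T).conn u v) =
      S.dual.conn (secFst u) (secSnd v) + T.conn (secSnd u) (secSnd v) := rfl

/-- The extension preserves both summands, so only the `V`-component survives. The last two terms
come from the bracket of `X` and `α`, which is `S*_X α - T*_α X`. -/
theorem extend_curv_left (X Y : Sec E F V) (α : Sec E (F →L[ℝ] ℝ) (DualB V)) :
    (extend S T).curv (secMk X 0) (secMk 0 α) (secMk Y 0) =
      secMk (S.conn X (T.predual.conn α Y) - T.predual.conn α (S.conn X Y)
        + S.conn (T.predual.conn α X) Y - T.predual.conn (S.dual.conn X α) Y) 0 := by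
  refine sec_prod_ext ?_ ?_
  · simp only [RAProduct.curv, RAProduct.bracket, secFst_sub, secFst_extend,
      secSnd_extend, secFst_secMk, secSnd_secMk, AConn.zero_left, AConn.zero_right, AConn.sub_left,
      zero_add, add_zero]
    abel
  · simp only [RAProduct.curv, RAProduct.bracket, secFst_sub, secSnd_sub, secFst_extend,
      secSnd_extend, secFst_secMk, secSnd_secMk, AConn.zero_left, AConn.zero_right,
      add_zero, sub_zero]

theorem extend_curv_right (α β : Sec E (F →L[ℝ] ℝ) (DualB V)) (X : Sec E F V) :
    (extend S T).curv (secMk 0 α) (secMk X 0) (secMk 0 β) =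
      secMk 0 (T.conn α (S.dual.conn X β) - S.dual.conn X (T.conn α β)
        - S.dual.conn (T.predual.conn α X) β + T.conn (S.dual.conn X α) β) := by
  refine sec_prod_ext ?_ ?_
  · simp only [RAProduct.curv, RAProduct.bracket, secFst_sub, secSnd_sub, secFst_extend,
      secSnd_extend, secFst_secMk, secSnd_secMk, AConn.zero_left, AConn.zero_right,
      add_zero, sub_zero]
  · simp only [RAProduct.curv, RAProduct.bracket, secSnd_sub, secFst_extend,
      secSnd_extend, secFst_secMk, secSnd_secMk, AConn.zero_left, AConn.zero_right, AConn.sub_left,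
      zero_add, add_zero]
    abel

end Extension

/-! ### Left symmetry, compatibility and the Codazzi equation -/

section Bivector

variable {E : Type*} [NormedAddCommGroup E] [NormedSpace ℝ E] [FiniteDimensional ℝ E]
  {M : Type*} [TopologicalSpace M] [ChartedSpace E M] [T2Space M] [IsManifold 𝓘(ℝ, E) ∞ M]
  {D : RAProduct (idAnchor E M)} {h : Bil E (E →L[ℝ] ℝ) (DualB (TB E M))}

theorem pair_predual_calD (D : RAProduct (idAnchor E M))
    (h : Bil E (E →L[ℝ] ℝ) (DualB (TB E M))) (α β : Form E M) (Y : Sec E E (TB E M)) :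
    pair β ((calD D h).predual.conn α Y) =
      pair β (D.conn (happ (sharp h) α) Y) - covBiv D Y h α β := by
  rw [AConn.pair_predual, pair_calD, pair_dual_idAnchor]
  ring

/-- `𝒟*_α Y = [h_# α, Y] + h_# (∇*_Y α)`. -/
theorem IsAffine.predual_calD (hD : IsAffine D) (α : Form E M) (Y : Sec E E (TB E M)) :
    (calD D h).predual.conn α Y =
      lie (happ (sharp h) α) Y + happ (sharp h) (D.dual.conn Y α) := section_ext fun β => by
  rw [pair_predual_calD, covBiv_eq_pair, pair_add, ← hD.torsionFree, pair_sub]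
  ring

/-- The term `∇_X h(α, β)` of `𝒟` is symmetric in `α, β`, so it drops out of the commutator. -/
theorem calD_bracket (D : RAProduct (idAnchor E M))
    (hsymm : ∀ x (α β : DualB (TB E M) x), (h x α β : ℝ) = h x β α) (α β : Form E M) :
    (calD D h).bracket α β =
      D.dual.conn (happ (sharp h) α) β - D.dual.conn (happ (sharp h) β) α := form_ext fun X => by
  rw [RAProduct.bracket, sub_pair, pair_calD, pair_calD, sub_pair, covBiv_comm D hsymm X β]
  ring

/-- The curvature of the extension of `(∇, 𝒟)` on `(X, α, Y)` is `-∇²_{X,Y} h (α, ·)`. -/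
theorem IsAffine.pair_extend_curv (hD : IsAffine D)
    (X Y : Sec E E (TB E M)) (α β : Form E M) :
    pair β (D.conn X ((calD D h).predual.conn α Y) - (calD D h).predual.conn α (D.conn X Y)
        + D.conn ((calD D h).predual.conn α X) Y
        - (calD D h).predual.conn (D.dual.conn X α) Y) = -covBiv₂ D X Y h α β := by
  have h1 := pair_dual_idAnchor D X ((calD D h).predual.conn α Y) β
  have h2 := pair_dual_idAnchor D X (D.conn (happ (sharp h) α) Y) β
  -- Flatness is applied to the pair `(X, h_# α)`; the bracket it produces cancels against the one
  -- in `𝒟*_α X = [h_# α, X] + h_#(∇*_X α)`.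
  have h3 := congrArg (pair β) (hD.conn_sub_conn X (happ (sharp h) α) Y)
  rw [pair_sub, lie_swap, D.neg_left, pair_neg] at h3
  simp only [pair_predual_calD, der_sub] at h1
  simp only [pair_sub, pair_add, pair_predual_calD, covBiv₂]
  rw [hD.predual_calD α X, D.add_left, pair_add]
  linear_combination h1 - h2 + h3

/-- The counterpart on `T*M` of `IsAffine.pair_extend_curv`: flatness of `∇*` along `(X, h_# α)`
removes every term free of `∇h`, leaving the same second derivative. -/
theorem IsAffine.pair_extend_curv_dual (hD : IsAffine D)
    (X Y : Sec E E (TB E M)) (α β : Form E M) :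
    pair ((calD D h).conn α (D.dual.conn X β) - D.dual.conn X ((calD D h).conn α β)
        - D.dual.conn ((calD D h).predual.conn α X) β
        + (calD D h).conn (D.dual.conn X α) β) Y = -covBiv₂ D X Y h α β := by
  have h3 := congrArg (fun γ => pair γ Y) (hD.dual_conn_sub_conn X (happ (sharp h) α) β)
  simp only [sub_pair] at h3
  rw [lie_swap, D.dual.neg_left, neg_pair, pair_dual_idAnchor D X Y] at h3
  simp only [sub_pair, add_pair, pair_calD, covBiv₂]
  rw [pair_dual_idAnchor D X Y ((calD D h).conn α β), pair_calD, pair_calD, der_add,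
    hD.predual_calD α X, D.dual.add_left, add_pair]
  linear_combination -h3

/-- The difference between the two sides of the Codazzi equation measures the failure of `h_#` to
preserve brackets. -/
theorem IsAffine.pair_lie_sub_sharp (hD : IsAffine D) (α β γ : Form E M) :
    pair γ (lie (happ (sharp h) α) (happ (sharp h) β) - happ (sharp h)
      (D.dual.conn (happ (sharp h) α) β - D.dual.conn (happ (sharp h) β) α)) =
      covBiv D (happ (sharp h) α) h β γ - covBiv D (happ (sharp h) β) h α γ := by
  rw [covBiv_eq_pair, covBiv_eq_pair, ← hD.torsionFree, happ_sub, pair_sub, pair_sub, pair_sub]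
  ring

/-- The anchor of a left symmetric algebroid commutes with the brackets, as far as this is seen by
sections. -/
theorem RAProduct.IsLeftSymmetric.der_smul_eq_zero {F : Type*} [NormedAddCommGroup F]
    [NormedSpace ℝ F] {V : M → Type*} [TopologicalSpace (TotalSpace F V)]
    [∀ x, AddCommGroup (V x)] [∀ x, Module ℝ (V x)] [∀ x, TopologicalSpace (V x)]
    [FiberBundle F V] [VectorBundle ℝ F V] {ρ : Anchor E F V} {T : RAProduct ρ}
    (hT : T.IsLeftSymmetric) (f : Fn E M) (a b c : Sec E F V) :
    (der (happ ρ a) (der (happ ρ b) f) - der (happ ρ b) (der (happ ρ a) f)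
      - der (happ ρ (T.bracket a b)) f) • c = 0 := by
  have h1 := hT a b (f • c)
  have h2 := hT a b c
  rw [RAProduct.curv] at h1 h2
  simp only [T.leibniz, T.add_right] at h1
  -- Subtracting `f • R(a, b) c = 0` from `R(a, b)(f • c) = 0` leaves only the terms in which `f` is
  -- differentiated.
  rw [← h1, ← sub_zero (f • T.conn a (T.conn b c) + _ + _ - _ - _), ← smul_zero f, ← h2]
  module

/-- Left symmetry forces the anchor to preserve brackets wherever a nonzero covector is available to
test it. -/
theorem IsAffine.codazzi_of_isLeftSymmetric (hD : IsAffine D)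
    (hsymm : ∀ x (α β : DualB (TB E M) x), (h x α β : ℝ) = h x β α)
    (hT : (calD D h).IsLeftSymmetric) (α β γ : Form E M) :
    covBiv D (happ (sharp h) α) h β γ - covBiv D (happ (sharp h) β) h α γ = 0 := by
  rw [← hD.pair_lie_sub_sharp]
  set Z := lie (happ (sharp h) α) (happ (sharp h) β) - happ (sharp h)
      (D.dual.conn (happ (sharp h) α) β - D.dual.conn (happ (sharp h) β) α) with hZ
  ext x
  -- Left symmetry gives `Z(f) γ = 0`, with `γ` itself as the section acted on. At zeros of `γ` the
  -- claim `⟨γ, Z⟩ = 0` is trivial; elsewhere `γ` can be cancelled.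
  by_cases hγ : γ x = 0
  · exact congrArg (fun l : DualB (TB E M) x => l (Z x)) hγ
  · have h1 : Z x = 0 := by
      refine eq_zero_of_der_eq_zero Z x fun f => ?_
      have h2 := hT.der_smul_eq_zero f α β γ
      rw [calD_bracket D hsymm, ← hD.der_lie, ← der_sub_left, ← hZ] at h2
      exact (smul_eq_zero.1 (congrArg (fun s : Form E M => s x) h2)).resolve_right hγ
    exact (congrArg (γ x) h1).trans (map_zero _)

theorem IsAffine.lie_sharp (hD : IsAffine D)
    (hC : ∀ α β γ : Form E M,
      covBiv D (happ (sharp h) α) h β γ - covBiv D (happ (sharp h) β) h α γ = 0)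
    (α β : Form E M) :
    lie (happ (sharp h) α) (happ (sharp h) β) = happ (sharp h)
      (D.dual.conn (happ (sharp h) α) β - D.dual.conn (happ (sharp h) β) α) := by
  rw [← sub_eq_zero]
  refine section_ext fun γ => ?_
  rw [hD.pair_lie_sub_sharp, hC, pair_zero]

/-- An expansion arranged for antisymmetrization in `α, β`: the derivatives of `h` are taken along
`h_#` of a form wherever a Codazzi difference is to appear, and the `∇_X h` terms either form a
symmetric pair or match `𝒟_{[α,β]} γ`. -/
theorem IsAffine.pair_calD_calD (hD : IsAffine D)
    (X : Sec E E (TB E M)) (α β γ : Form E M) :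
    pair ((calD D h).conn α ((calD D h).conn β γ)) X =
      der X (covBiv D (happ (sharp h) α) h β γ)
      - covBiv D (happ (sharp h) (D.dual.conn X α)) h β γ
      - covBiv D (happ (sharp h) α) h (D.dual.conn X β) γ
      - covBiv D (happ (sharp h) α) h β (D.dual.conn X γ)
      + covBiv D X h (D.dual.conn (happ (sharp h) α) β) γ
      + covBiv D X h β (D.dual.conn (happ (sharp h) α) γ)
      + covBiv D X h α (D.dual.conn (happ (sharp h) β) γ)
      + pair (D.dual.conn (happ (sharp h) α) (D.dual.conn (happ (sharp h) β) γ)) X := by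
  -- This trades `h_# α . ∇_X h(β, γ)` for `X . ∇_{h_# α} h(β, γ)`, so that the Codazzi equation can
  -- later be differentiated along `X`.
  have h1 := hD.covBiv₂_comm (h := h) X (happ (sharp h) α) β γ
  simp only [covBiv₂] at h1
  -- Written as a pairing, `∇_X h(α, 𝒟_β γ)` evaluates `𝒟_β γ` on vector fields, where its
  -- definition applies. The next line folds the `∇*_{h_# β} γ` part back into `∇_X h`.
  have h2 := covBiv_eq_pair D h X α ((calD D h).conn β γ)
  have h3 := covBiv_eq_pair D h X α (D.dual.conn (happ (sharp h) β) γ)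
  rw [pair_calD, pair_calD] at h2
  rw [pair_calD, pair_dual_idAnchor, pair_calD, pair_calD, pair_dual_idAnchor D _ X (D.dual.conn _ γ),
    der_add]
  linear_combination h2 - h3 - h1

/-- After antisymmetrization four Codazzi differences remain: one differentiated along `X`, and
three with `∇*_X` applied to one argument. The rest is the curvature of `∇*`, because `[h_# α, h_#
β]` is `h_#` of the bracket of `α` and `β`. -/
theorem IsAffine.calD_isLeftSymmetric (hD : IsAffine D)
    (hsymm : ∀ x (α β : DualB (TB E M) x), (h x α β : ℝ) = h x β α)
    (hC : ∀ α β γ : Form E M,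
      covBiv D (happ (sharp h) α) h β γ - covBiv D (happ (sharp h) β) h α γ = 0) :
    (calD D h).IsLeftSymmetric := fun α β γ => form_ext fun X => by
  have h1 := congrArg (fun δ => pair δ X)
    (hD.dual_conn_sub_conn (happ (sharp h) α) (happ (sharp h) β) γ)
  simp only [sub_pair] at h1
  rw [hD.lie_sharp hC] at h1
  have h2 := congrArg (der X) (hC α β γ)
  rw [der_sub, der_zero] at h2
  rw [RAProduct.curv, sub_pair, sub_pair, hD.pair_calD_calD, hD.pair_calD_calD,
    pair_calD, calD_bracket D hsymm, covBiv_sub_fst, zero_pair]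
  linear_combination h1 + h2 + hC (D.dual.conn X β) α γ - hC (D.dual.conn X α) β γ
    - hC α β (D.dual.conn X γ)

/-- The mixed curvatures are `-∇²_{X,Y} h(α, β)` for any `h`; their two symmetries are those of the
Hessian and of `h`. -/
theorem IsAffine.compatible_calD (hD : IsAffine D)
    (hsymm : ∀ x (α β : DualB (TB E M) x), (h x α β : ℝ) = h x β α)
    (hT : (calD D h).IsLeftSymmetric) : Compatible D (calD D h) where
  left := hD.isLeftSymmetric
  right := hT
  curv_left X Y α := by
    rw [extend_curv_left, extend_curv_left]
    refine congrArg (fun s => secMk s 0) (section_ext fun β => ?_)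
    rw [hD.pair_extend_curv, hD.pair_extend_curv, hD.covBiv₂_comm]
  curv_right α β X := by
    rw [extend_curv_right, extend_curv_right]
    refine congrArg (secMk 0) (form_ext fun Y => ?_)
    rw [hD.pair_extend_curv_dual, hD.pair_extend_curv_dual, covBiv₂_comm_forms D hsymm]

end Bivector

/-! ### The para-Kähler structure on `TM ⊕ T*M` -/

section ParaKahler

variable {E : Type*} [NormedAddCommGroup E] [NormedSpace ℝ E] [FiniteDimensional ℝ E]
  {M : Type*} [TopologicalSpace M] [ChartedSpace E M] [T2Space M] [IsManifold 𝓘(ℝ, E) ∞ M]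
  {D : RAProduct (idAnchor E M)} {h : Bil E (E →L[ℝ] ℝ) (DualB (TB E M))}

/-- Torsion-freeness writes the Lie bracket as a commutator of `∇`, so its algebraic rules follow
from those of a connection. -/
theorem IsAffine.lie_add_left (hD : IsAffine D) (X Y Z : Sec E E (TB E M)) :
    lie (X + Y) Z = lie X Z + lie Y Z := by
  simp only [← hD.torsionFree, D.add_left, D.add_right]
  abel

theorem IsAffine.lie_add_right (hD : IsAffine D) (X Y Z : Sec E E (TB E M)) :
    lie X (Y + Z) = lie X Y + lie X Z := by
  simp only [← hD.torsionFree, D.add_left, D.add_right]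
  abel

theorem IsAffine.lie_fsmul_right (hD : IsAffine D) (f : Fn E M) (X Y : Sec E E (TB E M)) :
    lie X (f • Y) = f • lie X Y + der X f • Y := by
  simp only [← hD.torsionFree, D.fsmul_left, D.leibniz, happ_idAnchor]
  module

theorem happ_phiAnchor (u : Sec E (E × (E →L[ℝ] ℝ)) (PhiTM E M)) :
    happ phiAnchor u = secFst u :=
  ContMDiffSection.ext fun x => add_zero (secFst u x)

theorem secFst_phiBracket (D : RAProduct (idAnchor E M))
    (u v : Sec E (E × (E →L[ℝ] ℝ)) (PhiTM E M)) :
    secFst (phiBracket D u v) = lie (secFst u) (secFst v) := rfl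

theorem secSnd_phiBracket (D : RAProduct (idAnchor E M))
    (u v : Sec E (E × (E →L[ℝ] ℝ)) (PhiTM E M)) :
    secSnd (phiBracket D u v) =
      D.dual.conn (secFst u) (secSnd v) - D.dual.conn (secFst v) (secSnd u) := rfl

/-- The bracket is the semidirect product of vector fields with the abelian algebra of `1`-forms, on
which they act by `∇*`. The form component of Jacobi is the flatness of `∇*`. -/
theorem IsAffine.isLieAlgebroid_phiBracket (hD : IsAffine D) :
    IsLieAlgebroid phiAnchor (phiBracket D) where
  add_right a b c := by
    refine sec_prod_ext ?_ ?_
    · simp only [secFst_phiBracket, secFst_add, hD.lie_add_right]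
    · simp only [secSnd_phiBracket, secSnd_add, secFst_add, D.dual.add_left, D.dual.add_right]
      abel
  skew a b := by
    refine sec_prod_ext ?_ ?_
    · rw [secFst_neg]; exact lie_swap _ _
    · rw [secSnd_neg, secSnd_phiBracket, secSnd_phiBracket, neg_sub]
  anchored f a b := by
    rw [happ_phiAnchor]
    refine sec_prod_ext ?_ ?_
    · simp only [secFst_phiBracket, secFst_add, secFst_fsmul, hD.lie_fsmul_right]
    · simp only [secSnd_phiBracket, secSnd_add, secFst_fsmul, secSnd_fsmul, D.dual.fsmul_left,
        D.dual.leibniz, happ_idAnchor]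
      module
  jacobi a b c := by
    refine sec_prod_ext ?_ ?_
    · exact hD.lie_jacobi _ _ _
    · simp only [secSnd_phiBracket, secFst_phiBracket, secSnd_add, secSnd_zero,
        ← hD.dual_conn_sub_conn, D.dual.sub_right]
      abel

theorem sharp_apply (x : M) (α β : DualB (TB E M) x) : (β (sharp h x α) : ℝ) = h x α β := by
  obtain ⟨α, rfl⟩ := exists_sec E (E →L[ℝ] ℝ) x α
  obtain ⟨β, rfl⟩ := exists_sec E (E →L[ℝ] ℝ) x β
  exact congrArg (fun f : Fn E M => f x) (pair_sharp h α β)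

theorem eq_zero_of_forall_dual (x : M) (v : TB E M x)
    (hv : ∀ β : DualB (TB E M) x, (β v : ℝ) = 0) : v = 0 := by
  have : FiniteDimensional ℝ (TB E M x) := ‹FiniteDimensional ℝ E›
  have : T2Space (TB E M x) := FiberBundle.t2Space E (TB E M) x
  rw [← Module.forall_dual_apply_eq_zero_iff ℝ]
  exact fun l => hv (LinearMap.toContinuousLinearMap l)

theorem hasSignature_phiMetric
    (hsymm : ∀ x (α β : DualB (TB E M) x), (h x α β : ℝ) = h x β α) (x : M) :
    HasSignature (fun u v : PhiTM E M x => (phiMetric h x u v : ℝ))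
      (Module.finrank ℝ E) (Module.finrank ℝ E) := by
  have : FiniteDimensional ℝ (TB E M x) := ‹FiniteDimensional ℝ E›
  have : T2Space (TB E M x) := FiberBundle.t2Space E (TB E M) x
  let b : Module.Basis (Fin (Module.finrank ℝ E)) ℝ (TB E M x) := Module.finBasis ℝ E
  let c (i : Fin (Module.finrank ℝ E)) : DualB (TB E M) x :=
    LinearMap.toContinuousLinearMap (b.coord i)
  have hc : ∀ i j, (c i (b j) : ℝ) = if i = j then 1 else 0 := fun i j => by
    show b.coord i (b j) = _
    rw [Module.Basis.coord_apply, Module.Basis.repr_self, Finsupp.single_apply]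
    simp only [eq_comm]
  -- The shear image of `(s b_i, c_i)`, with `c` the basis dual to `b`. The shear removes `h`, so
  -- `⟨w s i, w t j⟩ = δ_ij (s + t)`.
  let w (s : ℝ) (i : Fin (Module.finrank ℝ E)) : PhiTM E M x :=
    (s • b i + sharp h x (c i), c i)
  have hw : ∀ s t i j, (phiMetric h x (w s i) (w t j) : ℝ) = if i = j then s + t else 0 := by
    intro s t i j
    rw [phiMetric_apply]
    have h1 : (c i (t • b j + sharp h x (c j)) : ℝ) = t * c i (b j) + h x (c j) (c i) := by
      rw [← sharp_apply, map_add, map_smul]; rfl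
    have h2 : (c j (s • b i + sharp h x (c i)) : ℝ) = s * c j (b i) + h x (c i) (c j) := by
      rw [← sharp_apply, map_add, map_smul]; rfl
    show (c i (t • b j + sharp h x (c j)) : ℝ) + c j (s • b i + sharp h x (c i))
      - 2 * h x (c i) (c j) = _
    rw [h1, h2, hsymm x (c j), hc, hc]
    by_cases hij : i = j
    · subst hij; simp only [if_true]; ring
    · rw [if_neg hij, if_neg (Ne.symm hij), if_neg hij]; ring
  -- With `s, t = ±1/2` the sum `s + t` is `1`, `-1`, or `0` for mixed signs: a pseudo-orthonormal
  -- frame of neutral signature.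
  let e : Fin (Module.finrank ℝ E) ⊕ Fin (Module.finrank ℝ E) → PhiTM E M x :=
    Sum.elim (w (1 / 2)) (w (-1 / 2))
  have h1 : ∀ i j, i ≠ j → (phiMetric h x (e i) (e j) : ℝ) = 0 := by
    rintro (i | i) (j | j) hij
    all_goals
      simp only [e, Sum.elim_inl, Sum.elim_inr, hw]
      split_ifs with h0
      · first | exact absurd (congrArg _ h0) hij | norm_num
      · rfl
  have h2 : ∀ i, (phiMetric h x (e (Sum.inl i)) (e (Sum.inl i)) : ℝ) = 1 := fun i => by
    simp only [e, Sum.elim_inl, hw, if_true]; norm_num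
  have h3 : ∀ i, (phiMetric h x (e (Sum.inr i)) (e (Sum.inr i)) : ℝ) = -1 := fun i => by
    simp only [e, Sum.elim_inr, hw, if_true]; norm_num
  have hli : LinearIndependent ℝ e := by
    rw [Fintype.linearIndependent_iff]
    intro g hg i
    -- Pairing a linear relation with `e i` isolates its `i`-th coefficient, since the `e i` are
    -- orthogonal and non-null.
    let L : PhiTM E M x →ₗ[ℝ] ℝ :=
      { toFun := fun u => phiMetric h x u (e i)
        map_add' := fun u v => congrArg (fun l : DualB (PhiTM E M) x => l (e i))
          (map_add (phiMetric h x) u v)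
        map_smul' := fun r u => congrArg (fun l : DualB (PhiTM E M) x => l (e i))
          (map_smul (phiMetric h x) r u) }
    have h4 := congrArg L hg
    rw [map_sum, map_zero, Finset.sum_eq_single i] at h4
    · rw [map_smul, smul_eq_mul] at h4
      refine (mul_eq_zero.1 h4).resolve_right ?_
      rcases i with i | i
      · exact (h2 i).trans_ne one_ne_zero
      · exact (h3 i).trans_ne (neg_ne_zero.2 one_ne_zero)
    · intro k _ hk
      rw [map_smul, smul_eq_mul]
      exact mul_eq_zero_of_right _ (h1 k i hk)
    · exact fun hi => absurd (Finset.mem_univ i) hi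
  have hcard : Fintype.card (Fin (Module.finrank ℝ E) ⊕ Fin (Module.finrank ℝ E)) =
      Module.finrank ℝ (PhiTM E M x) := by
    have h6 : Module.finrank ℝ (DualB (TB E M) x) = Module.finrank ℝ E :=
      (LinearMap.toContinuousLinearMap (E := TB E M x) (F' := ℝ)).finrank_eq.symm.trans
        Subspace.dual_finrank_eq
    have h7 : Module.finrank ℝ (TB E M x) = Module.finrank ℝ E := rfl
    rw [Fintype.card_sum, Fintype.card_fin]
    refine Eq.trans ?_ (Module.finrank_prod (R := ℝ) (M := TB E M x) (M' := DualB (TB E M) x)).symm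
    rw [h6, h7]
  let B : Module.Basis (Fin (Module.finrank ℝ E) ⊕ Fin (Module.finrank ℝ E)) ℝ (PhiTM E M x) :=
    basisOfLinearIndependentOfCardEqFinrank' e hli hcard
  have hB : ∀ i, B i = e i := fun i =>
    congrFun (coe_basisOfLinearIndependentOfCardEqFinrank' e hli hcard) i
  refine ⟨B, fun i j hij => ?_, fun i => ?_, fun i => ?_⟩
  · simpa only [hB] using h1 i j hij
  · simpa only [hB] using h2 i
  · simpa only [hB] using h3 i

theorem isPseudoRiemannian_phiMetric
    (hsymm : ∀ x (α β : DualB (TB E M) x), (h x α β : ℝ) = h x β α) :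
    IsPseudoRiemannian (phiMetric h) where
  symm x u v := by
    rw [phiMetric_apply, phiMetric_apply, hsymm x u.2]
    ring
  nondegenerate x u hu := by
    have h1 : u.2 = 0 := ContinuousLinearMap.ext fun v => by
      have h2 := hu (v, 0)
      rw [phiMetric_apply] at h2
      simpa using h2
    have h3 : u.1 = 0 := eq_zero_of_forall_dual x u.1 fun β => by
      have h2 := hu (0, β)
      rw [phiMetric_apply, h1] at h2
      simpa using h2
    exact Prod.ext h3 h1
  signature := ⟨_, _, hasSignature_phiMetric hsymm⟩

/-- The bundle automorphism `X + α ↦ X + h_# α + α` of `TM ⊕ T*M`, on sections. -/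
noncomputable def shear (h : Bil E (E →L[ℝ] ℝ) (DualB (TB E M))) :
    Sec E (E × (E →L[ℝ] ℝ)) (PhiTM E M) ≃ₗ[Fn E M] Sec E (E × (E →L[ℝ] ℝ)) (PhiTM E M) where
  toFun u := secMk (secFst u + happ (sharp h) (secSnd u)) (secSnd u)
  invFun u := secMk (secFst u - happ (sharp h) (secSnd u)) (secSnd u)
  map_add' u v := sec_prod_ext
    (by
      simp only [secFst_secMk, secFst_add, secSnd_add, happ_add]
      abel)
    rfl
  map_smul' f u := sec_prod_ext
    (by simp only [secFst_secMk, secFst_fsmul, secSnd_fsmul, happ_fsmul, smul_add, RingHom.id_apply])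
    rfl
  left_inv u := sec_prod_ext (add_sub_cancel_right _ _) rfl
  right_inv u := sec_prod_ext (sub_add_cancel _ _) rfl

theorem secFst_shear (u : Sec E (E × (E →L[ℝ] ℝ)) (PhiTM E M)) :
    secFst (shear h u) = secFst u + happ (sharp h) (secSnd u) := rfl

theorem secSnd_shear (u : Sec E (E × (E →L[ℝ] ℝ)) (PhiTM E M)) :
    secSnd (shear h u) = secSnd u := rfl

theorem happ_phiAnchor_shear (u : Sec E (E × (E →L[ℝ] ℝ)) (PhiTM E M)) :
    happ phiAnchor (shear h u) = happ (sumAnchor (idAnchor E M) (sharp h)) u := by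
  rw [happ_phiAnchor]; rfl

/-- The extension of `(∇, 𝒟)`, transported along `shear`. -/
noncomputable def phiLeviCivita (D : RAProduct (idAnchor E M))
    (h : Bil E (E →L[ℝ] ℝ) (DualB (TB E M))) :
    AConn (phiAnchor (E := E) (M := M)) (E × (E →L[ℝ] ℝ)) (PhiTM E M) where
  conn u v := shear h ((extend D (calD D h)).conn ((shear h).symm u) ((shear h).symm v))
  add_left u u' v := by rw [map_add, AConn.add_left, map_add]
  add_right u v v' := by rw [map_add, AConn.add_right, map_add]
  fsmul_left f u v := by rw [map_smul, AConn.fsmul_left, map_smul]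
  leibniz f u v := by
    obtain ⟨u, rfl⟩ := (shear h).surjective u
    rw [map_smul, AConn.leibniz, map_add, map_smul, map_smul, happ_phiAnchor_shear]
    simp only [LinearEquiv.symm_apply_apply, LinearEquiv.apply_symm_apply]

theorem phiLeviCivita_conn_shear (u v : Sec E (E × (E →L[ℝ] ℝ)) (PhiTM E M)) :
    (phiLeviCivita D h).conn (shear h u) (shear h v) =
      shear h ((extend D (calD D h)).conn u v) := by
  simp only [phiLeviCivita, LinearEquiv.symm_apply_apply]

/-- The factor `2` is spelled as a repeated subtraction, so that no constant function enters the
ring identities. -/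
theorem bil_phiMetric (u v : Sec E (E × (E →L[ℝ] ℝ)) (PhiTM E M)) :
    bil (phiMetric h) u v = pair (secSnd u) (secFst v) + pair (secSnd v) (secFst u)
      - bil h (secSnd u) (secSnd v) - bil h (secSnd u) (secSnd v) := by
  ext x
  refine (phiMetric_apply h x (u x) (v x)).trans ?_
  rw [two_mul, ← sub_sub]
  rfl

/-- The two shear terms contribute `h(α, β) + h(β, α)`, which cancels `-2h(α, β)` by symmetry. -/
theorem bil_phiMetric_shear
    (hsymm : ∀ x (α β : DualB (TB E M) x), (h x α β : ℝ) = h x β α)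
    (u v : Sec E (E × (E →L[ℝ] ℝ)) (PhiTM E M)) :
    bil (phiMetric h) (shear h u) (shear h v) =
      pair (secSnd u) (secFst v) + pair (secSnd v) (secFst u) := by
  rw [bil_phiMetric]
  simp only [secFst_shear, secSnd_shear, pair_add, pair_sharp, bil_comm hsymm (secSnd v)]
  ring

/-- The shear adds `h_# α` and `K_h` subtracts it twice; the remaining `-h_# α` is the shear term of
`-α`. -/
theorem happ_phiK_shear (u : Sec E (E × (E →L[ℝ] ℝ)) (PhiTM E M)) :
    happ (phiK h) (shear h u) = shear h (secMk (secFst u) (-secSnd u)) := by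
  refine sec_prod_ext ?_ rfl
  rw [secFst_shear, secSnd_secMk, secFst_secMk, happ_neg]
  ext x
  show (u x).1 + sharp h x (u x).2 - (2 : ℝ) • sharp h x (u x).2 = (u x).1 + -sharp h x (u x).2
  module

/-- Metricity reduces, through the shear, to the duality of `∇` with `∇*` and of `𝒟` with `𝒟*` in
the canonical pairing. -/
theorem IsAffine.isLeviCivita_phiLeviCivita (hD : IsAffine D)
    (hsymm : ∀ x (α β : DualB (TB E M) x), (h x α β : ℝ) = h x β α)
    (hC : ∀ α β γ : Form E M,
      covBiv D (happ (sharp h) α) h β γ - covBiv D (happ (sharp h) β) h α γ = 0) :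
    IsLeviCivita (phiBracket D) (phiMetric h) (phiLeviCivita D h) where
  metric a b c := by
    obtain ⟨a, rfl⟩ := (shear h).surjective a
    obtain ⟨b, rfl⟩ := (shear h).surjective b
    obtain ⟨c, rfl⟩ := (shear h).surjective c
    simp only [phiLeviCivita_conn_shear, bil_phiMetric_shear hsymm, happ_phiAnchor_shear,
      happ_sumAnchor, der_add, der_add_left, secFst_extend, secSnd_extend, pair_add, add_pair,
      pair_dual_idAnchor, AConn.pair_predual, happ_idAnchor]
    ring
  torsionFree a b := by
    obtain ⟨a, rfl⟩ := (shear h).surjective a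
    obtain ⟨b, rfl⟩ := (shear h).surjective b
    have h1 := calD_bracket D hsymm (secSnd a) (secSnd b)
    rw [RAProduct.bracket] at h1
    rw [phiLeviCivita_conn_shear, phiLeviCivita_conn_shear, ← map_sub]
    have h2 : secSnd ((extend D (calD D h)).conn a b - (extend D (calD D h)).conn b a) =
        D.dual.conn (secFst a) (secSnd b) - D.dual.conn (secFst b) (secSnd a) +
        (D.dual.conn (happ (sharp h) (secSnd a)) (secSnd b) -
          D.dual.conn (happ (sharp h) (secSnd b)) (secSnd a)) := by
      rw [secSnd_sub, secSnd_extend, secSnd_extend, ← h1]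
      abel
    refine sec_prod_ext ?_ ?_
    -- Here alone the Codazzi equation enters: `h_#` of the bracket of forms becomes the bracket of
    -- vector fields `[h_# α, h_# β]`, and `𝒟*_α Y = [h_# α, Y] + h_#(∇*_Y α)` supplies the cross
    -- terms.
    · rw [secFst_shear, h2, happ_add, ← hD.lie_sharp hC, secFst_sub, secFst_extend,
        secFst_extend, hD.predual_calD, hD.predual_calD, secFst_phiBracket, secFst_shear,
        secFst_shear, hD.lie_add_left, hD.lie_add_right, hD.lie_add_right,
        ← hD.torsionFree (secFst a) (secFst b), happ_sub,
        lie_swap (secFst a) (happ (sharp h) (secSnd b))]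
      abel
    · rw [secSnd_shear, h2, secSnd_phiBracket, secFst_shear, secFst_shear, secSnd_shear,
        secSnd_shear, D.dual.add_left, D.dual.add_left]
      abel

/-- Before the shear, `K` is `Id ⊕ (-Id)`, and the extension preserves both summands. -/
theorem phiLeviCivita_phiK (a b : Sec E (E × (E →L[ℝ] ℝ)) (PhiTM E M)) :
    (phiLeviCivita D h).conn a (happ (phiK h) b) =
      happ (phiK h) ((phiLeviCivita D h).conn a b) := by
  obtain ⟨a, rfl⟩ := (shear h).surjective a
  obtain ⟨b, rfl⟩ := (shear h).surjective b
  rw [phiLeviCivita_conn_shear, happ_phiK_shear, happ_phiK_shear, phiLeviCivita_conn_shear]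
  refine congrArg (shear h) (sec_prod_ext rfl ?_)
  simp only [secSnd_extend, secSnd_secMk, AConn.neg_right, neg_add]

theorem IsAffine.isParaKahler (hD : IsAffine D)
    (hsymm : ∀ x (α β : DualB (TB E M) x), (h x α β : ℝ) = h x β α)
    (hC : ∀ α β γ : Form E M,
      covBiv D (happ (sharp h) α) h β γ - covBiv D (happ (sharp h) β) h α γ = 0) :
    IsParaKahler phiAnchor (phiBracket D) (phiMetric h) (phiK h) where
  lieAlgebroid := hD.isLieAlgebroid_phiBracket
  pseudoRiemannian := isPseudoRiemannian_phiMetric hsymm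
  involutive x u := by
    rw [phiK_apply, phiK_apply]
    refine Prod.ext ?_ (neg_neg _)
    show u.1 - (2 : ℝ) • sharp h x u.2 - (2 : ℝ) • sharp h x (-u.2) = u.1
    rw [map_neg]
    module
  skew x u v := by
    rw [phiK_apply, phiK_apply, phiMetric_apply, phiMetric_apply]
    have h1 : ∀ (α β : DualB (TB E M) x) (y : TB E M x),
        (α (y - (2 : ℝ) • sharp h x β) : ℝ) = α y - 2 * h x β α := fun α β y => by
      rw [← sharp_apply, map_sub, map_smul]; rfl
    have h2 : ∀ α β : DualB (TB E M) x, (h x (-α) β : ℝ) = -h x α β := fun α β => by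
      rw [map_neg]; rfl
    have h3 : ∀ α β : DualB (TB E M) x, (h x α (-β) : ℝ) = -h x α β := fun α β => map_neg _ _
    show -(u.2 v.1 : ℝ) + v.2 (u.1 - (2 : ℝ) • sharp h x u.2) - 2 * h x (-u.2) v.2 =
      -((u.2 (v.1 - (2 : ℝ) • sharp h x v.2) : ℝ) + -(v.2 u.1 : ℝ) - 2 * h x u.2 (-v.2))
    rw [h1, h1, h2, h3, hsymm x v.2]
    ring
  parallel := ⟨phiLeviCivita D h, hD.isLeviCivita_phiLeviCivita hsymm hC, phiLeviCivita_phiK⟩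

/-- `Ω_{K_h} (X + α, Y + β) = ⟨β, X⟩ - ⟨α, Y⟩`. -/
theorem fundForm_phiMetric_phiK (x : M) (u v : PhiTM E M x) :
    (fundForm (phiMetric h) (phiK h) x u v : ℝ) = (v.2 u.1 : ℝ) - (u.2 v.1 : ℝ) := by
  refine (phiMetric_apply h x (phiK h x u) v).trans ?_
  have h1 : (v.2 (u.1 - (2 : ℝ) • sharp h x u.2) : ℝ) = v.2 u.1 - 2 * h x u.2 v.2 := by
    rw [← sharp_apply, map_sub, map_smul]; rfl
  have h2 : (h x (-u.2) v.2 : ℝ) = -h x u.2 v.2 := by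
    rw [map_neg]; rfl
  show -(u.2 v.1 : ℝ) + v.2 (u.1 - (2 : ℝ) • sharp h x u.2) - 2 * h x (-u.2) v.2 = _
  rw [h1, h2]
  ring

theorem bil_fundForm (u v : Sec E (E × (E →L[ℝ] ℝ)) (PhiTM E M)) :
    bil (fundForm (phiMetric h) (phiK h)) u v =
      pair (secSnd v) (secFst u) - pair (secSnd u) (secFst v) := by
  ext x
  exact fundForm_phiMetric_phiK x (u x) (v x)

/-- The form is the canonical one, free of `h`. In its differential the derivatives cancel by the
definition of `∇*`, and what is left pairs forms with the torsion of `∇`. -/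
theorem IsAffine.isSymplectic (hD : IsAffine D) :
    IsSymplectic phiAnchor (phiBracket D) (fundForm (phiMetric h) (phiK h)) where
  skew x u v := by
    rw [fundForm_phiMetric_phiK, fundForm_phiMetric_phiK, neg_sub]
  nondegenerate x u hu := by
    refine Prod.ext (eq_zero_of_forall_dual x u.1 fun β => ?_) (ContinuousLinearMap.ext fun v => ?_)
    · have h2 := hu (0, β)
      rw [fundForm_phiMetric_phiK] at h2
      simpa using h2
    · have h2 := hu (v, 0)
      rw [fundForm_phiMetric_phiK] at h2
      simpa using h2
  closed a b c := by
    simp only [bil_fundForm, happ_phiAnchor, secFst_phiBracket, secSnd_phiBracket, sub_pair,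
      pair_dual_idAnchor, ← hD.torsionFree, pair_sub, der_sub]
    ring

end ParaKahler

end Algebroid

theorem theorem6p1 {E : Type*} [NormedAddCommGroup E] [NormedSpace ℝ E] [FiniteDimensional ℝ E]
    {M : Type*} [TopologicalSpace M] [ChartedSpace E M] [T2Space M] [IsManifold 𝓘(ℝ, E) ∞ M]
    (D : RAProduct (idAnchor E M)) (hD : IsAffine D)
    (h : Bil E (E →L[ℝ] ℝ) (DualB (TB E M)))
    (hsymm : ∀ x (α β : DualB (TB E M) x), (h x α β : ℝ) = h x β α) :
    (((calD D h).IsLeftSymmetric ∧ Compatible D (calD D h)) ↔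
      ∀ α β γ : Form E M,
        covBiv D (happ (sharp h) α) h β γ - covBiv D (happ (sharp h) β) h α γ = 0) ∧
    ((∀ α β γ : Form E M,
        covBiv D (happ (sharp h) α) h β γ - covBiv D (happ (sharp h) β) h α γ = 0) →
      IsParaKahler phiAnchor (phiBracket D) (phiMetric h) (phiK h) ∧
      (∀ x (u v : PhiTM E M x),
        (fundForm (phiMetric h) (phiK h) x u v : ℝ) = (v.2 u.1 : ℝ) - (u.2 v.1 : ℝ)) ∧
      IsSymplectic phiAnchor (phiBracket D) (fundForm (phiMetric h) (phiK h))) :=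
  ⟨⟨fun hT => hD.codazzi_of_isLeftSymmetric hsymm hT.1, fun hC =>
    ⟨hD.calD_isLeftSymmetric hsymm hC,
      hD.compatible_calD hsymm (hD.calD_isLeftSymmetric hsymm hC)⟩⟩,
    fun hC => ⟨hD.isParaKahler hsymm hC, fundForm_phiMetric_phiK, hD.isSymplectic⟩⟩
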